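/- Let $n\ge 1$, $z\in\mathbb R^n$, $\lambda_1,\lambda_2>0$, $l\in\mathbb R^n_-$, $u\in\mathbb R^n_+$ (so $l_i\le 0\le u_i$ for all $i$), $\Omega=\{x\in\mathbb R^n: l\le x\le u\}$, and $\widehat Bx=(x_1-x_2,\dots,x_{n-1}-x_n)$. Let $\delta_C$ be $0$ on the set $C$ and $+\infty$ off it, let $\|\cdot\|_0$ count nonzero entries, let $|\alpha|_0=0$ if $\alpha=0$ and $|\alpha|_0=1$ otherwise, and put $\omega_s(\alpha)=\lambda_2|\alpha|_0+\delta_{[l_s,u_s]}(\alpha)$ for $\alpha\in\mathbb R$. Consider the following algorithm (Algorithm 1). 1. Set $P_1^*(\alpha)=\frac12(z_1-\alpha)^2+\omega_1(\alpha)$ and $\mathcal R_1^0=\mathbb R$. 2. For $s=2,\dots,n$: 3. $\quad P_s^*(\alpha)=\min\{P_{s-1}^*(\alpha),\ \min_{\alpha'\in\mathbb R}P_{s-1}^*(\alpha')+\lambda_1\}+\frac12(\alpha-z_s)^2+\omega_s(\alpha)$; 4. $\quad \mathcal R_s^{s-1}=\{\alpha\in\mathbb R: P_{s-1}^*(\alpha)\ge\min_{\alpha'\in\mathbb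 R}P_{s-1}^*(\alpha')+\lambda_1\}$; 5. $\quad$ for $i=0,\dots,s-2$: $\ \mathcal R_s^i=\mathcal R_{s-1}^i\cap(\mathcal R_s^{s-1})^c$. 6. Set $s=n$. While $s>0$: find $\alpha_s^*\in\arg\min_{\alpha\in\mathbb R} P_s^*(\alpha)$ and the index $i_s^*\in\{0,\dots,s-1\}$ with $\alpha_s^*\in\mathcal R_s^{i_s^*}$; put $x^*_j=\alpha_s^*$ for $i_s^*<j\le s$; set $s\leftarrow i_s^*$. A function $f:\mathbb R\to(-\infty,+\infty]$ is called piecewise linear-quadratic with $k$ pieces if $\{f<+\infty\}$ is the union of $k$ pairwise disjoint intervals (open, closed, half-open or one-point) on each of which $f$ is a polynomial of degree at most two. Write $T(m)=O(m^{p+o(1)})$ if $T(m)=O(m^{p+\varepsilon_m})$ as $m\to\infty$ for some real sequence $\varepsilon_m\to0$. (a) There are constants $c_1,c_2>0$, independent of $s$, $n$ and the data $(z,\lambda_1,\lambda_2,l,u)$, such that for all $n$, all data and all $s\in\{2,\dots,n\}$ the function $P_s^*$ is piecewise linear-quadratic with at most $$3c_1s\exp\bigl(c_2\sqrt{\log 3s}\bigr)=O(s^{1+o(1)})$$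 pieces, and the list of pieces computed by the implementation in (b) is no longer than this. (b) Consider a real random access machine which performs, at unit cost, each arithmetic operation, square root and comparison of real numbers, each loading of a rational constant and each step of control flow. On it Algorithm 1, with the $P_s^*$ stored as lists of quadratic pieces and the $\mathcal R_s^i$ as lists of intervals, has the following properties. It computes the functions $P_s^*$ (each of which attains its minimum) and the sets $\mathcal R_s^i$ for $1\le s\le n$ and $0\le i\le s-1$. Its output $x^*$ is a point of the proximal mapping of $\lambda_1\|\widehat B\cdot\|_0+\lambda_2\|\cdot\|_0+\delta_\Omega$ at $z$, that is, a global minimizer over $x\in\mathbb R^n$ of $$\tfrac12\|x-z\|^2+\lambda_1\|\widehat Bx\|_0+\lambda_2\|x\|_0+\delta_\Omega(x).$$ The number of operations executed is at most $T(n)$, for a function $T$ of $n$ alone with $T(n)=O(n^{3+o(1)})$. -/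

import Mathlib

open Filter Topology Asymptotics

namespace FusedL0

/-! ## The proximal mapping of the fused `ℓ₀`-norms function with a box constraint -/

/-- The indicator function `δ_C` of a set: `0` on `C` and `+∞` off `C`. -/
noncomputable def delta {E : Type*} (C : Set E) (x : E) : EReal :=
  open Classical in if x ∈ C then 0 else ⊤

/-- The proximal mapping `prox_{μ h}(z) = argmin_x 1/(2μ) ‖x - z‖² + h(x)`. -/
def prox {n : ℕ} (μ : ℝ) (h : EuclideanSpace ℝ (Fin n) → EReal) (z : EuclideanSpace ℝ (Fin n)) :
    Set (EuclideanSpace ℝ (Fin n)) :=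
  {x | IsMinOn (fun y => ((1 / (2 * μ) * ‖y - z‖ ^ 2 : ℝ) : EReal) + h y) Set.univ x}

/-- The difference matrix `B̂` of size `(n-1) × n`, so that `B̂ x = (x₁ - x₂, …, xₙ₋₁ - xₙ)`. -/
def Bhat (n : ℕ) : Matrix (Fin (n - 1)) (Fin n) ℝ :=
  Matrix.of fun i j => if (j : ℕ) = i then 1 else if (j : ℕ) = i + 1 then -1 else 0

/-- The box `Ω = {x | l ≤ x ≤ u}`. -/
def box {n : ℕ} (l u : Fin n → ℝ) : Set (EuclideanSpace ℝ (Fin n)) :=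
  {x | ∀ i, l i ≤ x i ∧ x i ≤ u i}

/-- The function `λ₁ ‖B̂ x‖₀ + λ₂ ‖x‖₀ + δ_Ω(x)`; `hammingNorm` counts nonzero entries. -/
noncomputable def fusedReg {n : ℕ} (lam1 lam2 : ℝ) (l u : Fin n → ℝ)
    (x : EuclideanSpace ℝ (Fin n)) : EReal :=
  ((lam1 * (hammingNorm ((Bhat n).mulVec x.ofLp) : ℝ) + lam2 * (hammingNorm x.ofLp : ℝ) : ℝ) :
    EReal) + delta (box l u) x

/-! ## The functions and sets of the algorithm -/

/-- The `s`-th entry of a vector, entries being numbered `1, …, n`. -/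
def entry {n : ℕ} (v : Fin n → ℝ) (s : ℕ) : ℝ :=
  if h : s - 1 < n then v ⟨s - 1, h⟩ else 0

/-- `ω(α) = λ₂ |α|₀ + δ_{[l,u]}(α)`. -/
noncomputable def omega (lam2 l u α : ℝ) : EReal :=
  ((if α = 0 then 0 else lam2 : ℝ) : EReal) + delta (Set.Icc l u) α

/-- The functions `P_s^*` of the dynamic programming recursion, for `s = 1, …, n`
(the value at `s = 0` is not used). -/
noncomputable def Pstar {n : ℕ} (lam1 lam2 : ℝ) (z l u : Fin n → ℝ) : ℕ → ℝ → EReal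
  | 0 => fun _ => 0
  | 1 => fun α =>
      ((1 / 2 * (entry z 1 - α) ^ 2 : ℝ) : EReal) + omega lam2 (entry l 1) (entry u 1) α
  | s + 2 => fun α =>
      min (Pstar lam1 lam2 z l u (s + 1) α)
          ((⨅ α' : ℝ, Pstar lam1 lam2 z l u (s + 1) α') + (lam1 : EReal))
        + ((1 / 2 * (α - entry z (s + 2)) ^ 2 : ℝ) : EReal)
        + omega lam2 (entry l (s + 2)) (entry u (s + 2)) α

/-- The set `R_s^{s-1} = {α | P_{s-1}^*(α) ≥ min P_{s-1}^* + λ₁}`, for `s = 2, …, n`. -/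
def newSet {n : ℕ} (lam1 lam2 : ℝ) (z l u : Fin n → ℝ) (s : ℕ) : Set ℝ :=
  {α | (⨅ α' : ℝ, Pstar lam1 lam2 z l u (s - 1) α') + (lam1 : EReal)
      ≤ Pstar lam1 lam2 z l u (s - 1) α}

/-- The sets `R_s^i`, `i = 0, …, s - 1`: `R_1^0 = ℝ`, and `R_s^i = R_{s-1}^i ∩ (R_s^{s-1})ᶜ` for
`i ≤ s - 2` (they are empty for `i ≥ s`). -/
def Rset {n : ℕ} (lam1 lam2 : ℝ) (z l u : Fin n → ℝ) : ℕ → ℕ → Set ℝ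
  | 0, _ => ∅
  | 1, i => {_α | i = 0}
  | s + 2, i => if i = s + 1 then newSet lam1 lam2 z l u (s + 2)
      else Rset lam1 lam2 z l u (s + 1) i ∩ (newSet lam1 lam2 z l u (s + 2))ᶜ

/-- `f : ℝ → (-∞, +∞]` is piecewise linear-quadratic with `k` pieces: its domain splits into `k`
intervals (open, closed, half-open, one-point), and on each of them `f` is a polynomial of degree
at most two. -/
def IsPLQ (f : ℝ → EReal) (k : ℕ) : Prop :=
  ∃ (I : Fin k → Set ℝ) (a b c : Fin k → ℝ),
    (∀ j, (I j).OrdConnected) ∧ Pairwise (fun i j => Disjoint (I i) (I j)) ∧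
    (⋃ j, I j) = {α | f α ≠ ⊤} ∧
    ∀ j, ∀ α ∈ I j, f α = ((a j * α ^ 2 + b j * α + c j : ℝ) : EReal)

/-- `T(n) = O(n^{p+o(1)})` as `n → ∞`. -/
def IsBigOPow (T : ℕ → ℝ) (p : ℝ) : Prop :=
  ∃ ε : ℕ → ℝ, Tendsto ε atTop (𝓝 0) ∧ T =O[atTop] fun n : ℕ => (n : ℝ) ^ (p + ε n)

/-! ## A real random access machine with a step count

A computation is a sequence of elementary instructions on scalars of type `K`. Programs are written
for an arbitrary type `K`, so that the instructions are their only access to scalars. -/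

/-- The arithmetic instructions. -/
inductive ArithOp
  | add
  | sub
  | mul
  | div

/-- Computations with scalars in `K` that return a value in `A`. Every node except `ret` is one
elementary operation. -/
inductive Ram (K A : Type) : Type
  | ret (a : A) : Ram K A
  /-- one step of control flow -/
  | tick (next : Ram K A) : Ram K A
  /-- load a rational constant -/
  | const (q : ℚ) (next : K → Ram K A) : Ram K A
  | arith (op : ArithOp) (x y : K) (next : K → Ram K A) : Ram K A
  | sqrt (x : K) (next : K → Ram K A) : Ram K A
  /-- branch on `x < y` -/
  | less (x y : K) (next : Bool → Ram K A) : Ram K A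

namespace Ram

/-- Sequential composition. -/
def bind {K A B : Type} : Ram K A → (A → Ram K B) → Ram K B
  | ret a, f => f a
  | tick k, f => tick (bind k f)
  | const q k, f => const q fun r => bind (k r) f
  | arith op x y k, f => arith op x y fun r => bind (k r) f
  | sqrt x k, f => sqrt x fun r => bind (k r) f
  | less x y k, f => less x y fun r => bind (k r) f

instance {K : Type} : Monad (Ram K) where
  pure := ret
  bind := bind

/-- The arithmetic instructions on real numbers (with `x / 0 = 0`). -/
noncomputable def evalOp : ArithOp → ℝ → ℝ → ℝ
  | .add, x, y => x + y
  | .sub, x, y => x - y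
  | .mul, x, y => x * y
  | .div, x, y => x / y

/-- The value returned by a computation with exact real arithmetic. -/
noncomputable def val {A : Type} : Ram ℝ A → A
  | ret a => a
  | tick k => val k
  | const q k => val (k (q : ℝ))
  | arith op x y k => val (k (evalOp op x y))
  | sqrt x k => val (k (Real.sqrt x))
  | less x y k => val (k (decide (x < y)))

/-- The number of elementary operations executed by a computation with exact real arithmetic. -/
noncomputable def cost {A : Type} : Ram ℝ A → ℕ
  | ret _ => 0
  | tick k => cost k + 1
  | const q k => cost (k (q : ℝ)) + 1
  | arith op x y k => cost (k (evalOp op x y)) + 1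
  | sqrt x k => cost (k (Real.sqrt x)) + 1
  | less x y k => cost (k (decide (x < y))) + 1

/-- One step of control flow. -/
def step {K : Type} : Ram K Unit := tick (ret ())

/-- Load a rational constant. -/
def lit {K : Type} (q : ℚ) : Ram K K := const q ret

/-- Addition. -/
def addC {K : Type} (x y : K) : Ram K K := arith .add x y ret

/-- Subtraction. -/
def subC {K : Type} (x y : K) : Ram K K := arith .sub x y ret

/-- Multiplication. -/
def mulC {K : Type} (x y : K) : Ram K K := arith .mul x y ret

/-- Division. -/
def divC {K : Type} (x y : K) : Ram K K := arith .div x y ret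

/-- Square root. -/
def sqrtC {K : Type} (x : K) : Ram K K := sqrt x ret

/-- Comparison. -/
def ltC {K : Type} (x y : K) : Ram K Bool := less x y ret

end Ram

open FusedL0.Ram

/-! ## Data structures -/

/-- A cut of the line: at `-∞`, at `+∞`, immediately before `a` (`pt a false`) or immediately
after `a` (`pt a true`). -/
inductive Cut (K : Type)
  | negInf
  | posInf
  | pt (a : K) (after : Bool)

/-- An interval, given by its two end cuts. Thus `[a, b]` is `pt a false, pt b true`. -/
structure Ivl (K : Type) where
  lo : Cut K
  hi : Cut K

/-- A quadratic polynomial `a α² + b α + d` on an interval. -/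
structure Piece (K : Type) where
  ivl : Ivl K
  a : K
  b : K
  d : K

/-- The data computed for one value of `s`: the pieces of `P_s^*` from left to right, and the sets
`R_s^{s-1}, R_s^{s-2}, …, R_s^0` in this order, each as a list of intervals. -/
structure Stage (K : Type) where
  P : List (Piece K)
  R : List (List (Ivl K))

/-- The cut lies to the left of the real number `α`. -/
def Cut.isLeftOf (α : ℝ) : Cut ℝ → Prop
  | .negInf => True
  | .posInf => False
  | .pt a false => a ≤ α
  | .pt a true => a < α

/-- The set of real numbers between the two end cuts of an interval. -/
def Ivl.toSet (I : Ivl ℝ) : Set ℝ := {α | I.lo.isLeftOf α ∧ ¬ I.hi.isLeftOf α}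

/-- The union of a list of intervals. -/
def unionSet (L : List (Ivl ℝ)) : Set ℝ := {α | ∃ I ∈ L, α ∈ I.toSet}

/-- The function `ℝ → (-∞, +∞]` given by a list of pieces, `+∞` outside all of them. -/
noncomputable def pieceFun : List (Piece ℝ) → ℝ → EReal
  | [], _ => ⊤
  | p :: ps, α => open Classical in
      if α ∈ p.ivl.toSet then ((p.a * α ^ 2 + p.b * α + p.d : ℝ) : EReal) else pieceFun ps α

/-! ## The algorithm

Each call of a procedure below is charged one step, and so is every elementary operation on
scalars. Apart from these a call handles a bounded number of list cells. -/

section Program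

variable {K : Type}

/-- Is the cut `c` strictly to the left of the cut `c'`? -/
def cutLt : Cut K → Cut K → Ram K Bool
  | .negInf, .negInf => do step; return false
  | .negInf, _ => do step; return true
  | _, .negInf => do step; return false
  | .posInf, _ => do step; return false
  | _, .posInf => do step; return true
  | .pt a p, .pt b q => do
      step
      if ← ltC a b then return true
      else if ← ltC b a then return false
      else return (!p && q)

/-- The right one of two cuts. -/
def cutMax (c c' : Cut K) : Ram K (Cut K) := do
  step
  if ← cutLt c c' then return c' else return c

/-- The left one of two cuts. -/
def cutMin (c c' : Cut K) : Ram K (Cut K) := do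
  step
  if ← cutLt c c' then return c else return c'

/-- The intersection of two intervals (the resulting end cuts may be out of order). -/
def ivlMeet (I J : Ivl K) : Ram K (Ivl K) := do
  step
  let lo ← cutMax I.lo J.lo
  let hi ← cutMin I.hi J.hi
  return ⟨lo, hi⟩

/-- Is the cut to the left of the point `α`? -/
def cutLeftOf (α : K) : Cut K → Ram K Bool
  | .negInf => do step; return true
  | .posInf => do step; return false
  | .pt a false => do
      step
      let r ← ltC α a
      return !r
  | .pt a true => do step; ltC a α

/-- Is the point `α` in the interval? -/
def ivlMem (α : K) (I : Ivl K) : Ram K Bool := do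
  step
  let p ← cutLeftOf α I.lo
  let q ← cutLeftOf α I.hi
  return (p && !q)

/-- The value of the quadratic of a piece at a point. -/
def quadAt (p : Piece K) (α : K) : Ram K K := do
  step
  let r ← mulC p.a α
  let r ← addC r p.b
  let r ← mulC r α
  addC r p.d

/-- Move `α` up to the cut if it is to the left of it. -/
def clampLo (α : K) : Cut K → Ram K K
  | .pt a _ => do
      step
      if ← ltC α a then return a else return α
  | _ => do step; return α

/-- Move `α` down to the cut if it is to the right of it. -/
def clampHi (α : K) : Cut K → Ram K K
  | .pt a _ => do
      step
      if ← ltC a α then return a else return α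
  | _ => do step; return α

/-- A minimizer over the closure of a piece and its value, as a pair (value, minimizer). -/
def minPiece (p : Piece K) : Ram K (K × K) := do
  step
  let zero ← lit 0
  let num ← subC zero p.b
  let den ← addC p.a p.a
  let v ← divC num den
  let v ← clampLo v p.ivl.lo
  let v ← clampHi v p.ivl.hi
  let m ← quadAt p v
  return (m, v)

/-- The minimum value and a minimizer of a function given by its pieces (`none` if there is no
piece). -/
def minimize : List (Piece K) → Ram K (Option (K × K))
  | [] => do step; return none
  | p :: ps => do
      step
      let best ← minPiece p
      match ← minimize ps with
      | none => return some best
      | some other =>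
          if ← ltC other.1 best.1 then return some other else return some best

/-- Prepend an interval on which the new constant is taken, joining it to the following interval
if that is of the same kind, and dropping it if it is empty. In the lists of parts below, `true`
marks the parts on which the new constant is taken. -/
def pushNew (c : K) (lo hi : Cut K) (rest : List (Bool × Piece K)) :
    Ram K (List (Bool × Piece K)) := do
  step
  if ← cutLt lo hi then
    match rest with
    | (true, p) :: t => return (true, { p with ivl := ⟨lo, p.ivl.hi⟩ }) :: t
    | _ =>
        let zero ← lit 0
        return (true, ⟨⟨lo, hi⟩, zero, zero, c⟩) :: rest
  else return rest

/-- The interval on which the quadratic of a piece is `< c`; `none` if there is none. -/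
def sublevel (c : K) (p : Piece K) : Ram K (Option (Ivl K)) := do
  step
  let zero ← lit 0
  let two ← lit 2
  let twoA ← mulC two p.a
  let e ← subC p.d c
  let twoE ← mulC two e
  let bb ← mulC p.b p.b
  let ae4 ← mulC twoA twoE
  let disc ← subC bb ae4
  if ← ltC zero disc then
    let r ← sqrtC disc
    let nb ← subC zero p.b
    let x ← subC nb r
    let y ← addC nb r
    let x ← divC x twoA
    let y ← divC y twoA
    let J ← ivlMeet p.ivl ⟨.pt x true, .pt y false⟩
    if ← cutLt J.lo J.hi then return some J else return none
  else return none

/-- The function `min {f, c}` on the part of the line to the right of the cut `cur`, where `f` is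
given by its pieces: a list of consecutive parts, marked `true` where `f ≥ c`. -/
def truncate (c : K) : Cut K → List (Piece K) → Ram K (List (Bool × Piece K))
  | cur, [] => do
      step
      pushNew c cur .posInf []
  | cur, p :: ps => do
      step
      let rest ← truncate c p.ivl.hi ps
      match ← sublevel c p with
      | none =>
          let rest ← pushNew c p.ivl.lo p.ivl.hi rest
          pushNew c cur p.ivl.lo rest
      | some J =>
          let rest ← pushNew c J.hi p.ivl.hi rest
          let rest ← pushNew c p.ivl.lo J.lo ((false, { p with ivl := J }) :: rest)
          pushNew c cur p.ivl.lo rest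

/-- Prepend the restriction of a piece to an interval, after adding `α²/2 - z α + e` to it. -/
def pushRestr (z e : K) (J : Ivl K) (p : Piece K) (rest : List (Piece K)) :
    Ram K (List (Piece K)) := do
  step
  let I ← ivlMeet p.ivl J
  if ← cutLt I.lo I.hi then
    let half ← lit (1 / 2)
    let a ← addC p.a half
    let b ← subC p.b z
    let d ← addC p.d e
    return ⟨I, a, b, d⟩ :: rest
  else return rest

/-- Add `(α - z)²/2 + λ₂ |α|₀ + δ_{[l,u]}(α)` to a function given by consecutive parts. -/
def addTerm (lam2 z l u : K) : List (Bool × Piece K) → Ram K (List (Piece K))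
  | [] => do step; return []
  | (_, p) :: ps => do
      step
      let rest ← addTerm lam2 z l u ps
      let zero ← lit 0
      let half ← lit (1 / 2)
      let zz ← mulC z z
      let e ← mulC half zz
      let e' ← addC e lam2
      let rest ← pushRestr z e' ⟨.pt zero true, .pt u true⟩ p rest
      let rest ← pushRestr z e ⟨.pt zero false, .pt zero true⟩ p rest
      pushRestr z e' ⟨.pt l false, .pt zero false⟩ p rest

/-- The intervals of the parts with a given mark. -/
def marked (b : Bool) : List (Bool × Piece K) → Ram K (List (Ivl K))
  | [] => do step; return []
  | (b', p) :: ps => do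
      step
      let rest ← marked b ps
      if b' = b then return p.ivl :: rest else return rest

/-- Prepend the nonempty intersections of an interval with the intervals of a list. -/
def meetOne (I : Ivl K) (rest : List (Ivl K)) : List (Ivl K) → Ram K (List (Ivl K))
  | [] => do step; return rest
  | J :: Js => do
      step
      let tail ← meetOne I rest Js
      let M ← ivlMeet I J
      if ← cutLt M.lo M.hi then return M :: tail else return tail

/-- The intersection of two unions of intervals. -/
def meetLists (old : List (Ivl K)) : List (Ivl K) → Ram K (List (Ivl K))
  | [] => do step; return []
  | I :: Is => do
      step
      let rest ← meetLists old Is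
      meetOne I rest old

/-- Intersect each of the sets `R_{s-1}^i` with the union `(R_s^{s-1})ᶜ` of `old`. -/
def meetAll (old : List (Ivl K)) : List (List (Ivl K)) → Ram K (List (List (Ivl K)))
  | [] => do step; return []
  | L :: Ls => do
      step
      let rest ← meetAll old Ls
      let L' ← meetLists old L
      return L' :: rest

/-- Initialization: `P_1^*` and `R_1^0`. -/
def initStage (lam2 z l u : K) : Ram K (Stage K) := do
  step
  let zero ← lit 0
  let P ← addTerm lam2 z l u [(true, ⟨⟨.negInf, .posInf⟩, zero, zero, zero⟩)]
  return ⟨P, [[⟨.negInf, .posInf⟩]]⟩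

/-- One pass of the forward loop: from `P_{s-1}^*` and the `R_{s-1}^i` to `P_s^*` and the `R_s^i`. -/
def nextStage (lam1 lam2 z l u : K) (st : Stage K) : Ram K (Stage K) := do
  step
  match ← minimize st.P with
  | none => return ⟨[], []⟩
  | some best =>
      let c ← addC best.1 lam1
      let parts ← truncate c .negInf st.P
      let P ← addTerm lam2 z l u parts
      let new ← marked true parts
      let old ← marked false parts
      let R ← meetAll old st.R
      return ⟨P, new :: R⟩

/-- The forward loop `s = 2, …, n` over the data `(z_s, l_s, u_s)` that are left, starting at the stage
`st`; `done` holds the earlier stages, the latest one first. -/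
def forward (lam1 lam2 : K) (st : Stage K) (done : List (Stage K)) :
    List (K × K × K) → Ram K (List (Stage K))
  | [] => do step; return st :: done
  | (z, l, u) :: ds => do
      step
      let st' ← nextStage lam1 lam2 z l u st
      forward lam1 lam2 st' (st :: done) ds

/-- Does one of the intervals contain `α`? -/
def memList (α : K) : List (Ivl K) → Ram K Bool
  | [] => do step; return false
  | I :: Is => do
      step
      if ← ivlMem α I then return true else memList α Is

/-- The position of the first set that contains `α`; with the sets `R_s^{s-1}, …, R_s^0` this is
`s - 1 - i_s^*`. -/
def findSet (α : K) : List (List (Ivl K)) → Ram K ℕ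
  | [] => do step; return 0
  | L :: Ls => do
      step
      if ← memList α L then return 0
      else
        let k ← findSet α Ls
        return k + 1

/-- The backward loop `s ← i_s^*`. The list holds the stages `s, s - 1, …, 1`, and `x` the entries
`x_{s+1}, …, x_n`. If `k > 0`, then `s` lies in the block of the last value `α` found, and `k`
entries of this block are left. If `k = 0`, then a minimizer `α_s^*` of `P_s^*` and the `i_s^*` with
`α_s^* ∈ R_s^{i_s^*}` are computed. -/
def backward : List (Stage K) → ℕ → Option K → List K → Ram K (List K)
  | [], _, _, x => do step; return x
  | _ :: sts, k + 1, some α, x => do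
      step
      backward sts k (some α) (α :: x)
  | st :: sts, _, _, x => do
      step
      match ← minimize st.P with
      | none => return x
      | some best =>
          let α := best.2
          let k ← findSet α st.R
          backward sts k (some α) (α :: x)

/-- The algorithm. It returns the stages `n, n - 1, …, 1` and the entries of `x^*`. -/
def algorithm (lam1 lam2 : K) : List (K × K × K) → Ram K (List (Stage K) × List K)
  | [] => do step; return ([], [])
  | (z, l, u) :: ds => do
      step
      let st ← initStage lam2 z l u
      let stages ← forward lam1 lam2 st [] ds
      let x ← backward stages 0 none []
      return (stages, x)

end Program

/-- The run of the algorithm on given real data. -/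
noncomputable def algorithmRun {n : ℕ} (lam1 lam2 : ℝ) (z l u : Fin n → ℝ) :
    Ram ℝ (List (Stage ℝ) × List ℝ) :=
  algorithm lam1 lam2 (List.ofFn fun i => (z i, l i, u i))

end FusedL0

/-! Membership in `R_s^i` means that the threshold was taken at stage `i` and never since. There
`P_s^*` is a single function, `branch`: a constant plus the terms `i + 1, …, s`. A term jumps only
at `0` and at the ends of its box, so off `0` a branch is one convex quadratic on an interval.
Counting pieces therefore amounts to counting the switches between the sets `R_s^i`.

Off `0` these sets do not interlace (`Rset_not_interlaced`). Let `i < j` and `α < β < γ` with `α, γ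
∈ R_s^i` and `β ∈ R_s^j`. At stage `j` the branch of `i` is below the threshold at `α` and `γ`,
hence by convexity at `β`; but it dominates `P_j^*`, which at `β` is not below the threshold. A word
over `s` letters without equal neighbours and without a pattern `a b a`, `a < b`, has length at most
`2 s` (`length_le_of_not_interlaced`). Each side of `0` thus carries at most `2 s` pieces, and
`P_s^*` has at most `4 s + 1`. This linear bound is stronger than the one claimed, whose exponential
factor is only used as a number `≥ 1`.

The computed list obeys the same count because `truncate` joins neighbouring stretches on which the
constant is taken: between two computed pieces on one side of `0` that lie in the same `R_s^i` there
is always a point outside `R_s^i`. The invariant `Inv` carries this separation, and `Inv.next`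
preserves it. The intervals of all the `R_s^i` together number `O(s)`, since every interval that
survives a truncation sits inside one interval of the previous family. Intersecting two lists of
length `O(s)` dominates a pass, so a pass costs `O(s²)` and the algorithm `O(n³)`.

Optimality is dynamic programming: `Pstar_le_energy` bounds every competitor from below, and
`backward_spec` shows that the output reaches the bound. Minimizers are computed on closures of
pieces; they are genuine because `P_s^*` is lower semicontinuous. -/

namespace FusedL0
-- Values and costs of composed computations
namespace Ram
variable {A B : Type}

@[simp] theorem val_pure (a : A) : val (pure a : Ram ℝ A) = a := rfl
@[simp] theorem cost_pure (a : A) : cost (pure a : Ram ℝ A) = 0 := rfl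

@[simp] theorem val_bind (m : Ram ℝ A) (f : A → Ram ℝ B) : val (m >>= f) = val (f (val m)) := by
  change val (Ram.bind m f) = _
  induction m with
  | less x y k ih => simpa [Ram.bind, val] using ih _
  | _ => simp_all [Ram.bind, val]

@[simp] theorem cost_bind (m : Ram ℝ A) (f : A → Ram ℝ B) :
    cost (m >>= f) = cost m + cost (f (val m)) := by
  change cost (Ram.bind m f) = _
  induction m with
  | less x y k ih => simp only [Ram.bind, val, cost, ih]; omega
  | _ => simp_all [Ram.bind, val, cost] <;> omega

@[simp] theorem cost_step : cost (step : Ram ℝ Unit) = 1 := rfl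
@[simp] theorem val_lit (q : ℚ) : val (lit q : Ram ℝ ℝ) = q := rfl
@[simp] theorem cost_lit (q : ℚ) : cost (lit q : Ram ℝ ℝ) = 1 := rfl
@[simp] theorem val_addC (x y : ℝ) : val (addC x y) = x + y := rfl
@[simp] theorem cost_addC (x y : ℝ) : cost (addC x y) = 1 := rfl
@[simp] theorem val_subC (x y : ℝ) : val (subC x y) = x - y := rfl
@[simp] theorem cost_subC (x y : ℝ) : cost (subC x y) = 1 := rfl
@[simp] theorem val_mulC (x y : ℝ) : val (mulC x y) = x * y := rfl
@[simp] theorem cost_mulC (x y : ℝ) : cost (mulC x y) = 1 := rfl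
@[simp] theorem val_divC (x y : ℝ) : val (divC x y) = x / y := rfl
@[simp] theorem cost_divC (x y : ℝ) : cost (divC x y) = 1 := rfl
@[simp] theorem val_sqrtC (x : ℝ) : val (sqrtC x) = √x := rfl
@[simp] theorem cost_sqrtC (x : ℝ) : cost (sqrtC x) = 1 := rfl
@[simp] theorem val_ltC (x y : ℝ) : val (ltC x y) = decide (x < y) := rfl
@[simp] theorem cost_ltC (x y : ℝ) : cost (ltC x y) = 1 := rfl

@[simp] theorem val_ite (p : Prop) [Decidable p] (x y : Ram ℝ A) :
    val (if p then x else y) = if p then val x else val y := by split <;> rfl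
@[simp] theorem cost_ite (p : Prop) [Decidable p] (x y : Ram ℝ A) :
    cost (if p then x else y) = if p then cost x else cost y := by split <;> rfl

end Ram

open Ram

/-! ### Cuts and intervals -/

/-- The points to the right of a cut. -/
def Cut.up (c : Cut ℝ) : Set ℝ := {α | c.isLeftOf α}

/-- There is a point between two cuts. -/
def Cut.lt (c c' : Cut ℝ) : Prop := ∃ α, α ∈ c.up ∧ α ∉ c'.up

@[simp] theorem Cut.up_negInf : (Cut.negInf : Cut ℝ).up = Set.univ := rfl
@[simp] theorem Cut.up_posInf : (Cut.posInf : Cut ℝ).up = ∅ := rfl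
@[simp] theorem Cut.up_false (a : ℝ) : (Cut.pt a false).up = Set.Ici a := rfl
@[simp] theorem Cut.up_true (a : ℝ) : (Cut.pt a true).up = Set.Ioi a := rfl

theorem Ivl.mem_toSet {I : Ivl ℝ} {α : ℝ} : α ∈ I.toSet ↔ α ∈ I.lo.up ∧ α ∉ I.hi.up := Iff.rfl

theorem Cut.up_mono {c : Cut ℝ} {α β : ℝ} (h : α ∈ c.up) (hab : α ≤ β) : β ∈ c.up := by
  rcases c with _ | _ | ⟨a, _ | _⟩ <;> simp_all <;> linarith

theorem Cut.lt_of_mem {c : Cut ℝ} {α β : ℝ} (h : α ∉ c.up) (hb : β ∈ c.up) : α < β := by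
  by_contra hn
  exact h (c.up_mono hb (not_lt.1 hn))

/-- Cuts are compared through their upper sets, a chain under inclusion. All later reasoning about
order uses these sets and never the representation of a cut. -/
theorem Cut.not_lt_iff {c c' : Cut ℝ} : ¬ c.lt c' ↔ c.up ⊆ c'.up := by
  simp [Cut.lt, Set.subset_def]

theorem Cut.lt.subset {c c' : Cut ℝ} (h : c.lt c') : c'.up ⊆ c.up := by
  obtain ⟨α, h1, h2⟩ := h
  intro β hβ
  exact c.up_mono h1 (Cut.lt_of_mem h2 hβ).le

theorem Ivl.nonempty_iff {I : Ivl ℝ} : I.toSet.Nonempty ↔ I.lo.lt I.hi := Iff.rfl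

theorem Ivl.ordConnected (I : Ivl ℝ) : I.toSet.OrdConnected := by
  refine ⟨fun x hx y hy w hw => ?_⟩
  exact ⟨I.lo.up_mono hx.1 hw.1, fun h => hy.2 (I.hi.up_mono h hw.2)⟩

-- For `a < b` the midpoint lies between the cuts whatever the flags are. At equal points only
-- "before `a`, after `a`" leaves room, namely for `a` itself.
@[simp] theorem val_cutLt (c c' : Cut ℝ) : val (cutLt c c') = true ↔ c.lt c' := by
  rcases c with _ | _ | ⟨a, p⟩ <;> rcases c' with _ | _ | ⟨b, q⟩ <;>
    simp only [cutLt, val_bind, val_pure, val_ltC, val_ite, decide_eq_true_eq]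
  · simp [Cut.lt]
  · simp [Cut.lt]
  · simp only [true_iff]
    refine ⟨b - 1, trivial, ?_⟩
    cases q <;> simp
  · simp [Cut.lt]
  · simp [Cut.lt]
  · simp [Cut.lt]
  · simp [Cut.lt]
  · simp only [true_iff]
    refine ⟨a + 1, ?_, by simp⟩
    cases p <;> simp
  · split_ifs with h1 h2
    · simp only [true_iff]
      refine ⟨(a + b) / 2, ?_, ?_⟩
      · cases p <;> simp <;> linarith
      · cases q <;> simp <;> linarith
    · simp only [false_iff, Cut.not_lt_iff]
      intro x hx
      cases p <;> cases q <;> simp_all <;> linarith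
    · obtain rfl : a = b := le_antisymm (not_lt.1 h2) (not_lt.1 h1)
      cases p <;> cases q <;> simp [Cut.lt]
      · exact ⟨a, le_refl _, le_refl _⟩
      · exact fun x hx => hx.le

theorem cost_cutLt (c c' : Cut ℝ) : cost (cutLt c c') ≤ 3 := by
  rcases c with _ | _ | ⟨a, p⟩ <;> rcases c' with _ | _ | ⟨b, q⟩ <;> simp [cutLt]
  split_ifs <;> simp

theorem up_cutMax (c c' : Cut ℝ) : (val (cutMax c c')).up = c.up ∩ c'.up := by
  simp only [cutMax, val_bind, val_ite, val_pure]
  split_ifs with h <;> rw [val_cutLt] at h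
  · exact (Set.inter_eq_right.2 h.subset).symm
  · exact (Set.inter_eq_left.2 (Cut.not_lt_iff.1 h)).symm

theorem up_cutMin (c c' : Cut ℝ) : (val (cutMin c c')).up = c.up ∪ c'.up := by
  simp only [cutMin, val_bind, val_ite, val_pure]
  split_ifs with h <;> rw [val_cutLt] at h
  · exact (Set.union_eq_left.2 h.subset).symm
  · exact (Set.union_eq_right.2 (Cut.not_lt_iff.1 h)).symm

/-- The intersection of two intervals, as computed by `ivlMeet`. -/
noncomputable def Ivl.meet (I J : Ivl ℝ) : Ivl ℝ := val (ivlMeet I J)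

@[simp] theorem val_ivlMeet (I J : Ivl ℝ) : val (ivlMeet I J) = I.meet J := rfl

theorem Ivl.up_meet_lo (I J : Ivl ℝ) : (I.meet J).lo.up = I.lo.up ∩ J.lo.up := by
  simp [Ivl.meet, ivlMeet, up_cutMax]

theorem Ivl.up_meet_hi (I J : Ivl ℝ) : (I.meet J).hi.up = I.hi.up ∪ J.hi.up := by
  simp [Ivl.meet, ivlMeet, up_cutMin]

theorem Ivl.toSet_meet (I J : Ivl ℝ) : (I.meet J).toSet = I.toSet ∩ J.toSet := by
  ext α
  simp only [Set.mem_inter_iff, Ivl.mem_toSet, Ivl.up_meet_lo, Ivl.up_meet_hi, Set.mem_union]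
  tauto

theorem cost_ivlMeet (I J : Ivl ℝ) : cost (ivlMeet I J) ≤ 9 := by
  have h1 := cost_cutLt I.lo J.lo
  have h2 := cost_cutLt I.hi J.hi
  simp only [ivlMeet, cutMax, cutMin, cost_bind, cost_step, cost_ite, cost_pure, ite_self]
  omega

@[simp] theorem val_cutLeftOf (α : ℝ) (c : Cut ℝ) : val (cutLeftOf α c) = true ↔ α ∈ c.up := by
  rcases c with _ | _ | ⟨a, _ | _⟩ <;> simp [cutLeftOf]

theorem cost_cutLeftOf (α : ℝ) (c : Cut ℝ) : cost (cutLeftOf α c) ≤ 2 := by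
  rcases c with _ | _ | ⟨a, _ | _⟩ <;> simp [cutLeftOf]

@[simp] theorem val_ivlMem (α : ℝ) (I : Ivl ℝ) : val (ivlMem α I) = true ↔ α ∈ I.toSet := by
  simp [ivlMem, Ivl.mem_toSet, ← Bool.not_eq_true]

theorem cost_ivlMem (α : ℝ) (I : Ivl ℝ) : cost (ivlMem α I) ≤ 5 := by
  have h1 := cost_cutLeftOf α I.lo
  have h2 := cost_cutLeftOf α I.hi
  simp only [ivlMem, cost_bind, cost_step, cost_pure]
  omega

/-! ### Quadratic pieces -/

/-- The quadratic polynomial of a piece. -/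
def Piece.quad (p : Piece ℝ) (α : ℝ) : ℝ := p.a * α ^ 2 + p.b * α + p.d

@[simp] theorem val_quadAt (p : Piece ℝ) (α : ℝ) : val (quadAt p α) = p.quad α := by
  simp [quadAt, Piece.quad]; ring

theorem cost_quadAt (p : Piece ℝ) (α : ℝ) : cost (quadAt p α) = 5 := by
  simp [quadAt]

theorem cost_clampLo (α : ℝ) (c : Cut ℝ) : cost (clampLo α c) ≤ 2 := by
  rcases c with _ | _ | ⟨a, _ | _⟩ <;> simp [clampLo]

theorem cost_clampHi (α : ℝ) (c : Cut ℝ) : cost (clampHi α c) ≤ 2 := by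
  rcases c with _ | _ | ⟨a, _ | _⟩ <;> simp [clampHi]

theorem cost_minPiece (p : Piece ℝ) : cost (minPiece p) ≤ 14 := by
  simp only [minPiece, cost_bind, cost_step, cost_pure, cost_quadAt, cost_lit, cost_subC, cost_addC,
    cost_divC]
  have := cost_clampLo (val (divC (val (subC (val (lit 0)) p.b)) (val (addC p.a p.a)))) p.ivl.lo
  have := cost_clampHi (val (clampLo (val (divC (val (subC (val (lit 0)) p.b)) (val (addC p.a p.a))))
    p.ivl.lo)) p.ivl.hi
  omega

theorem cost_minimize (ps : List (Piece ℝ)) : cost (minimize ps) ≤ 16 * ps.length + 1 := by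
  induction ps with
  | nil => simp [minimize]
  | cons p ps ih =>
    have h := cost_minPiece p
    simp only [minimize, cost_bind, cost_step, List.length_cons]
    cases val (minimize ps) <;> simp <;> omega

/-! ### Operation counts, output lengths and values of the list procedures -/

theorem cost_pushNew (c : ℝ) (lo hi : Cut ℝ) (rest : List (Bool × Piece ℝ)) :
    cost (pushNew c lo hi rest) ≤ 5 := by
  have h := cost_cutLt lo hi
  simp only [pushNew, cost_bind, cost_step, cost_ite, cost_pure]
  rcases rest with _ | ⟨⟨_ | _, p⟩, t⟩ <;> simp <;> try split_ifs
  all_goals omega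

theorem length_pushNew (c : ℝ) (lo hi : Cut ℝ) (rest : List (Bool × Piece ℝ)) :
    (val (pushNew c lo hi rest)).length ≤ rest.length + 1 := by
  simp only [pushNew, val_bind, val_ite, val_pure]
  rcases rest with _ | ⟨⟨_ | _, p⟩, t⟩ <;> simp <;> split_ifs <;> simp

theorem cost_sublevel (c : ℝ) (p : Piece ℝ) : cost (sublevel c p) ≤ 29 := by
  simp only [sublevel, cost_bind, cost_step, cost_ite, cost_pure, cost_lit, cost_mulC, cost_subC,
    cost_addC, cost_divC, cost_ltC, cost_sqrtC, ite_self, val_ivlMeet, Nat.add_zero]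
  generalize hJ : (Ivl.mk _ _ : Ivl ℝ) = J
  have h1 := cost_ivlMeet p.ivl J
  have h2 := cost_cutLt (p.ivl.meet J).lo (p.ivl.meet J).hi
  split_ifs <;> omega

theorem cost_truncate (c : ℝ) (cur : Cut ℝ) (ps : List (Piece ℝ)) :
    -- Per piece: one step, 29 for `sublevel`, and at most three calls of `pushNew` at 5 each.
    cost (truncate c cur ps) ≤ 45 * ps.length + 6 := by
  induction ps generalizing cur with
  | nil =>
    have := cost_pushNew c cur .posInf []
    simp only [truncate, cost_bind, cost_step, List.length_nil]
    omega
  | cons p ps ih =>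
    have h1 := ih p.ivl.hi
    have h2 := cost_sublevel c p
    simp only [truncate, cost_bind, cost_step, List.length_cons]
    cases val (sublevel c p) with
    | none =>
      simp only [cost_bind]
      have h3 := cost_pushNew c p.ivl.lo p.ivl.hi (val (truncate c p.ivl.hi ps))
      have h4 := cost_pushNew c cur p.ivl.lo
        (val (pushNew c p.ivl.lo p.ivl.hi (val (truncate c p.ivl.hi ps))))
      omega
    | some J =>
      simp only [cost_bind]
      have h3 := cost_pushNew c J.hi p.ivl.hi (val (truncate c p.ivl.hi ps))
      set r1 := val (pushNew c J.hi p.ivl.hi (val (truncate c p.ivl.hi ps)))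
      have h4 := cost_pushNew c p.ivl.lo J.lo ((false, { p with ivl := J }) :: r1)
      set r2 := val (pushNew c p.ivl.lo J.lo ((false, { p with ivl := J }) :: r1))
      have h5 := cost_pushNew c cur p.ivl.lo r2
      omega

/-- A piece contributes at most its sublevel interval and three stretches of the constant: before
the piece, and inside it on either side of that interval. One stretch may follow the last piece. -/
theorem length_truncate (c : ℝ) (cur : Cut ℝ) (ps : List (Piece ℝ)) :
    (val (truncate c cur ps)).length ≤ 4 * ps.length + 1 := by
  induction ps generalizing cur with
  | nil =>
    have := length_pushNew c cur .posInf []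
    simpa [truncate] using this
  | cons p ps ih =>
    have h1 := ih p.ivl.hi
    simp only [truncate, val_bind, List.length_cons]
    cases val (sublevel c p) with
    | none =>
      simp only [val_bind]
      have h3 := length_pushNew c p.ivl.lo p.ivl.hi (val (truncate c p.ivl.hi ps))
      have h4 := length_pushNew c cur p.ivl.lo
        (val (pushNew c p.ivl.lo p.ivl.hi (val (truncate c p.ivl.hi ps))))
      omega
    | some J =>
      simp only [val_bind]
      have h3 := length_pushNew c J.hi p.ivl.hi (val (truncate c p.ivl.hi ps))
      set r1 := val (pushNew c J.hi p.ivl.hi (val (truncate c p.ivl.hi ps)))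
      have h4 := length_pushNew c p.ivl.lo J.lo ((false, { p with ivl := J }) :: r1)
      set r2 := val (pushNew c p.ivl.lo J.lo ((false, { p with ivl := J }) :: r1))
      have h5 := length_pushNew c cur p.ivl.lo r2
      simp only [List.length_cons] at h4
      omega

theorem cost_pushRestr (z e : ℝ) (J : Ivl ℝ) (p : Piece ℝ) (rest : List (Piece ℝ)) :
    cost (pushRestr z e J p rest) ≤ 17 := by
  have h1 := cost_ivlMeet p.ivl J
  have h2 := cost_cutLt (p.ivl.meet J).lo (p.ivl.meet J).hi
  simp only [pushRestr, cost_bind, cost_step, val_ivlMeet, cost_ite, cost_lit, cost_addC, cost_subC,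
    cost_pure]
  split_ifs <;> omega

theorem cost_addTerm (lam2 z l u : ℝ) (ps : List (Bool × Piece ℝ)) :
    cost (addTerm lam2 z l u ps) ≤ 57 * ps.length + 1 := by
  induction ps with
  | nil => simp [addTerm]
  | cons x ps ih =>
    obtain ⟨b, p⟩ := x
    simp only [addTerm, cost_bind, cost_step, List.length_cons, cost_lit, cost_mulC, cost_addC]
    generalize (val (addTerm lam2 z l u ps)) = r0
    generalize val (mulC _ _) = e
    generalize val (addC _ _) = e'
    have h1 := cost_pushRestr z e' ⟨.pt (val (lit 0)) true, .pt u true⟩ p r0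
    set r1 := val (pushRestr z e' ⟨.pt (val (lit 0)) true, .pt u true⟩ p r0)
    have h2 := cost_pushRestr z e ⟨.pt (val (lit 0)) false, .pt (val (lit 0)) true⟩ p r1
    set r2 := val (pushRestr z e ⟨.pt (val (lit 0)) false, .pt (val (lit 0)) true⟩ p r1)
    have h3 := cost_pushRestr z e' ⟨.pt l false, .pt (val (lit 0)) false⟩ p r2
    omega

theorem cost_marked (b : Bool) (ps : List (Bool × Piece ℝ)) :
    cost (marked b ps) = ps.length + 1 := by
  induction ps with
  | nil => simp [marked]
  | cons x ps ih => simp [marked, ih]; omega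

theorem val_marked (b : Bool) (ps : List (Bool × Piece ℝ)) :
    val (marked b ps) = (ps.filter (fun x => x.1 = b)).map (fun x => x.2.ivl) := by
  induction ps with
  | nil => simp [marked]
  | cons x ps ih =>
    simp only [marked, val_bind, ih, val_ite, val_pure, List.filter_cons]
    split_ifs <;> simp_all

open Classical in
/-- The nonempty intersections of an interval with those of a list. -/
noncomputable def meets (old : List (Ivl ℝ)) (I : Ivl ℝ) : List (Ivl ℝ) :=
  (old.map I.meet).filter (fun M => M.lo.lt M.hi)

theorem val_meetOne (I : Ivl ℝ) (rest old : List (Ivl ℝ)) :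
    val (meetOne I rest old) = meets old I ++ rest := by
  induction old with
  | nil => simp [meetOne, meets]
  | cons J Js ih =>
    simp only [meetOne, val_bind, ih, val_ivlMeet, val_cutLt, val_ite, val_pure, meets,
      List.map_cons, List.filter_cons]
    split_ifs <;> simp_all

theorem cost_meetOne (I : Ivl ℝ) (rest old : List (Ivl ℝ)) :
    cost (meetOne I rest old) ≤ 13 * old.length + 1 := by
  induction old with
  | nil => simp [meetOne]
  | cons J Js ih =>
    have h1 := cost_ivlMeet I J
    have h2 := cost_cutLt (I.meet J).lo (I.meet J).hi
    simp only [meetOne, cost_bind, val_ivlMeet, cost_step, cost_ite, cost_pure, ite_self,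
      List.length_cons]
    omega

theorem val_meetLists (old L : List (Ivl ℝ)) :
    val (meetLists old L) = L.flatMap (meets old) := by
  induction L with
  | nil => simp [meetLists]
  | cons I Is ih => simp [meetLists, ih, val_meetOne]

theorem cost_meetLists (old L : List (Ivl ℝ)) :
    cost (meetLists old L) ≤ L.length * (13 * old.length + 2) + 1 := by
  induction L with
  | nil => simp [meetLists]
  | cons I Is ih =>
    have := cost_meetOne I (val (meetLists old Is)) old
    simp only [meetLists, cost_bind, cost_step, List.length_cons, add_mul, one_mul]
    nlinarith

theorem val_meetAll (old : List (Ivl ℝ)) (R : List (List (Ivl ℝ))) :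
    val (meetAll old R) = R.map (fun L => L.flatMap (meets old)) := by
  induction R with
  | nil => simp [meetAll]
  | cons I Is ih => simp [meetAll, ih, val_meetLists]

theorem cost_meetAll (old : List (Ivl ℝ)) (R : List (List (Ivl ℝ))) :
    cost (meetAll old R) ≤ 2 * R.length + R.flatten.length * (13 * old.length + 2) + 1 := by
  induction R with
  | nil => simp [meetAll]
  | cons L Ls ih =>
    have := cost_meetLists old L
    simp only [meetAll, cost_bind, cost_step, List.length_cons, List.flatten_cons, List.length_append,
      add_mul, cost_pure]
    nlinarith

theorem cost_memList (α : ℝ) (L : List (Ivl ℝ)) : cost (memList α L) ≤ 6 * L.length + 1 := by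
  induction L with
  | nil => simp [memList]
  | cons I Is ih =>
    have := cost_ivlMem α I
    simp only [memList, cost_bind, cost_step, List.length_cons, cost_ite, cost_pure]
    split_ifs <;> omega

theorem val_memList (α : ℝ) (L : List (Ivl ℝ)) :
    val (memList α L) = true ↔ α ∈ unionSet L := by
  induction L with
  | nil => simp [memList, unionSet]
  | cons I Is ih =>
    simp only [memList, val_bind, val_ite, val_pure]
    split_ifs with h <;> rw [val_ivlMem] at h <;> simp [unionSet, h]
    simpa [unionSet] using ih

theorem cost_findSet (α : ℝ) (R : List (List (Ivl ℝ))) :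
    cost (findSet α R) ≤ 2 * R.length + 6 * R.flatten.length + 1 := by
  induction R with
  | nil => simp [findSet]
  | cons L Ls ih =>
    have := cost_memList α L
    simp only [findSet, cost_bind, cost_step, List.length_cons, cost_ite, cost_pure,
      List.flatten_cons, List.length_append]
    split_ifs <;> omega

theorem findSet_spec (α : ℝ) (R : List (List (Ivl ℝ))) (h : ∃ L ∈ R, α ∈ unionSet L) :
    ∃ L, R[val (findSet α R)]? = some L ∧ α ∈ unionSet L := by
  induction R with
  | nil => simp at h
  | cons L Ls ih =>
    simp only [findSet, val_bind, val_ite, val_pure]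
    split_ifs with hL <;> rw [val_memList] at hL
    · exact ⟨L, by simp, hL⟩
    · obtain ⟨M, hM, hα⟩ := h
      rcases List.mem_cons.1 hM with rfl | hM
      · exact absurd hα hL
      · simpa using ih ⟨M, hM, hα⟩


/-! ### Minimization of a list of pieces -/

/-- The open interval between `v` and the known point `α` is contained in `I`, and `v` is an end of
it. -/
theorem mem_closure_of_clamped {I : Ivl ℝ} {v α : ℝ} (hα : α ∈ I.toSet)
    (h1 : ∀ w, v < w → w ∈ I.lo.up) (h2 : ∀ w, w < v → w ∉ I.hi.up) : v ∈ closure I.toSet := by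
  rcases lt_trichotomy v α with h | rfl | h
  · have : v ∈ closure (Set.Ioo v α) := by
      rw [closure_Ioo h.ne]; exact Set.left_mem_Icc.2 h.le
    refine closure_mono (fun w hw => ?_) this
    exact ⟨h1 w hw.1, fun hh => hα.2 (I.hi.up_mono hh hw.2.le)⟩
  · exact subset_closure hα
  · have : v ∈ closure (Set.Ioo α v) := by
      rw [closure_Ioo h.ne]; exact Set.right_mem_Icc.2 h.le
    refine closure_mono (fun w hw => ?_) this
    exact ⟨I.lo.up_mono hα.1 hw.1.le, h2 w hw.2⟩

/-- The last alternative says that if the point was moved, the whole interval lies beyond `v` as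
seen from `v₀`. So no point of the interval is nearer to `v₀` than `v`. -/
theorem clamp_spec {I : Ivl ℝ} (hI : I.lo.lt I.hi) (v₀ : ℝ) :
    let v := val (clampHi (val (clampLo v₀ I.lo)) I.hi)
    (∀ w, v < w → w ∈ I.lo.up) ∧ (∀ w, w < v → w ∉ I.hi.up) ∧
      (v = v₀ ∨ (v₀ < v ∧ ∀ α ∈ I.lo.up, v ≤ α) ∨ (v < v₀ ∧ ∀ α, α ∉ I.hi.up → α ≤ v)) := by
  obtain ⟨lo, hi⟩ := I
  obtain ⟨α, h1, h2⟩ := hI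
  rcases lo with _ | _ | ⟨a, _ | _⟩ <;> rcases hi with _ | _ | ⟨b, _ | _⟩ <;>
    simp [clampLo, clampHi] at h1 h2 ⊢ <;> split_ifs <;>
    grind

/-- A quadratic with positive leading coefficient increases with the distance to its vertex `v₀`,
and clamping minimizes this distance. At an open end the clamped point is only in the closure of the
piece. -/
theorem minPiece_spec {p : Piece ℝ} (ha : 0 < p.a) (hp : p.ivl.lo.lt p.ivl.hi) :
    (val (minPiece p)).1 = p.quad (val (minPiece p)).2 ∧
      (val (minPiece p)).2 ∈ closure p.ivl.toSet ∧
      ∀ α ∈ p.ivl.toSet, (val (minPiece p)).1 ≤ p.quad α := by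
  simp only [minPiece, val_bind, val_pure, val_quadAt, val_lit, val_subC, val_addC, val_divC]
  obtain ⟨h1, h2, h3⟩ := clamp_spec hp (((0 : ℚ) - p.b : ℝ) / (p.a + p.a))
  set v₀ := (((0 : ℚ) - p.b : ℝ) / (p.a + p.a)) with hv₀
  set v := val (clampHi (val (clampLo v₀ p.ivl.lo)) p.ivl.hi)
  obtain ⟨α₀, hα₀⟩ := Ivl.nonempty_iff.2 hp
  refine ⟨trivial, mem_closure_of_clamped hα₀ h1 h2, fun α hα => ?_⟩
  have hb : p.b = - (2 * p.a * v₀) := by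
    rw [hv₀]; push_cast; field_simp; ring
  have hq : p.quad α - p.quad v = p.a * ((α - v₀) ^ 2 - (v - v₀) ^ 2) := by
    simp only [Piece.quad, hb]; ring
  have : (v - v₀) ^ 2 ≤ (α - v₀) ^ 2 := by
    rcases h3 with h | ⟨h, h'⟩ | ⟨h, h'⟩
    · rw [h]; simpa using sq_nonneg _
    · have := h' α hα.1
      nlinarith
    · have := h' α hα.2
      nlinarith
  nlinarith [mul_nonneg ha.le (sub_nonneg.2 this)]

theorem minimize_spec {ps : List (Piece ℝ)} (hne : ps ≠ [])
    (h : ∀ p ∈ ps, 0 < p.a ∧ p.ivl.lo.lt p.ivl.hi) :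
    ∃ m v, val (minimize ps) = some (m, v) ∧
      (∃ p ∈ ps, m = p.quad v ∧ v ∈ closure p.ivl.toSet) ∧
      ∀ p ∈ ps, ∀ α ∈ p.ivl.toSet, m ≤ p.quad α := by
  induction ps with
  | nil => exact absurd rfl hne
  | cons p ps ih =>
    obtain ⟨ha, hp⟩ := h p (by simp)
    obtain ⟨h1, h2, h3⟩ := minPiece_spec ha hp
    by_cases hps : ps = []
    · subst hps
      refine ⟨_, _, by simp [minimize], ⟨p, by simp, h1, h2⟩, ?_⟩
      simpa using h3
    · obtain ⟨m, v, hv, ⟨p', hp', hm, hcl⟩, hmin⟩ := ih hps (fun q hq => h q (by simp [hq]))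
      simp only [minimize, val_bind, hv, val_ite, val_pure, val_ltC, decide_eq_true_eq]
      split_ifs with hlt
      · refine ⟨m, v, rfl, ⟨p', by simp [hp'], hm, hcl⟩, ?_⟩
        intro q hq α hα
        rcases List.mem_cons.1 hq with rfl | hq
        · exact hlt.le.trans (h3 α hα)
        · exact hmin q hq α hα
      · refine ⟨_, _, rfl, ⟨p, by simp, h1, h2⟩, ?_⟩
        intro q hq α hα
        rcases List.mem_cons.1 hq with rfl | hq
        · exact h3 α hα
        · exact (not_lt.1 hlt).trans (hmin q hq α hα)

/-! ### Truncation -/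

/-- By convexity the set where the quadratic is below `c` is the open interval between two roots, or
empty. The two inclusions keep the ends of `J` within the piece, so that the stretches on both sides
of `J` can be pushed in order. -/
theorem sublevel_spec (c : ℝ) {p : Piece ℝ} (ha : 0 < p.a) :
    (val (sublevel c p) = none ∧ ∀ α ∈ p.ivl.toSet, c ≤ p.quad α) ∨
    ∃ J, val (sublevel c p) = some J ∧ J.lo.lt J.hi ∧ J.lo.up ⊆ p.ivl.lo.up ∧
      p.ivl.hi.up ⊆ J.hi.up ∧ ∀ α ∈ p.ivl.toSet, α ∈ J.toSet ↔ p.quad α < c := by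
  simp only [sublevel, val_bind, val_ite, val_pure, val_lit, val_subC, val_addC, val_mulC, val_divC,
    val_sqrtC, val_ltC, decide_eq_true_eq, val_ivlMeet]
  push_cast
  split_ifs with h1 h2
  · rw [val_cutLt] at h2
    right
    refine ⟨_, rfl, h2, ?_, ?_, ?_⟩
    · rw [Ivl.up_meet_lo]; exact Set.inter_subset_left
    · rw [Ivl.up_meet_hi]; exact Set.subset_union_left
    · intro α hα
      rw [Ivl.toSet_meet]
      set r := √(p.b * p.b - 2 * p.a * (2 * (p.d - c))) with hr
      have hr2 : r ^ 2 = p.b * p.b - 2 * p.a * (2 * (p.d - c)) := Real.sq_sqrt h1.le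
      have hr0 : 0 < r := Real.sqrt_pos.2 h1
      simp only [Set.mem_inter_iff, hα, true_and, Ivl.mem_toSet, Cut.up_true, Cut.up_false,
        Set.mem_Ioi, Set.mem_Ici, not_le]
      rw [div_lt_iff₀ (by positivity), lt_div_iff₀ (by positivity)]
      -- Completing the square avoids division: below `c` means `|2 a α + b| < r`.
      have key : 4 * p.a * (p.quad α - c) = (2 * p.a * α + p.b) ^ 2 - r ^ 2 := by
        rw [hr2]; simp only [Piece.quad]; ring
      constructor
      · rintro ⟨h3, h4⟩
        by_contra hn
        have : 0 ≤ 4 * p.a * (p.quad α - c) := mul_nonneg (by positivity) (by linarith)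
        nlinarith
      · intro h
        have : 4 * p.a * (p.quad α - c) < 0 := mul_neg_of_pos_of_neg (by positivity) (by linarith)
        have := abs_lt_of_sq_lt_sq (by linarith : (2 * p.a * α + p.b) ^ 2 < r ^ 2) hr0.le
        rw [abs_lt] at this
        constructor <;> nlinarith
  · rw [val_cutLt, Cut.not_lt_iff] at h2
    left
    refine ⟨rfl, fun α hα => ?_⟩
    by_contra hn
    have h3 : α ∈ (p.ivl.meet ⟨.pt ((0 - p.b - √(p.b * p.b - 2 * p.a * (2 * (p.d - c)))) /
      (2 * p.a)) true, .pt ((0 - p.b + √(p.b * p.b - 2 * p.a * (2 * (p.d - c)))) /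
      (2 * p.a)) false⟩).toSet := by
      rw [Ivl.toSet_meet]
      set r := √(p.b * p.b - 2 * p.a * (2 * (p.d - c))) with hr
      have hr2 : r ^ 2 = p.b * p.b - 2 * p.a * (2 * (p.d - c)) := Real.sq_sqrt h1.le
      have hr0 : 0 < r := Real.sqrt_pos.2 h1
      simp only [Set.mem_inter_iff, hα, true_and, Ivl.mem_toSet, Cut.up_true, Cut.up_false,
        Set.mem_Ioi, Set.mem_Ici, not_le]
      rw [div_lt_iff₀ (by positivity), lt_div_iff₀ (by positivity)]
      have key : 4 * p.a * (p.quad α - c) = (2 * p.a * α + p.b) ^ 2 - r ^ 2 := by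
        rw [hr2]; simp only [Piece.quad]; ring
      have : 4 * p.a * (p.quad α - c) < 0 := mul_neg_of_pos_of_neg (by positivity) (by linarith)
      have := abs_lt_of_sq_lt_sq (by linarith : (2 * p.a * α + p.b) ^ 2 < r ^ 2) hr0.le
      rw [abs_lt] at this
      constructor <;> nlinarith
    exact h3.2 (h2 h3.1)
  · left
    refine ⟨rfl, fun α hα => ?_⟩
    have key : 4 * p.a * (p.quad α - c) = (2 * p.a * α + p.b) ^ 2 -
        (p.b * p.b - 2 * p.a * (2 * (p.d - c))) := by
      simp only [Piece.quad]; ring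
    have : 0 ≤ 4 * p.a * (p.quad α - c) := by rw [key]; nlinarith [sq_nonneg (2 * p.a * α + p.b)]
    have := nonneg_of_mul_nonneg_right this (by positivity)
    linarith

/-- The pieces are nonempty and lie to the right of a cut, from left to right. -/
def SortedFrom : Cut ℝ → List (Piece ℝ) → Prop
  | _, [] => True
  | c, p :: ps => p.ivl.lo.up ⊆ c.up ∧ p.ivl.lo.lt p.ivl.hi ∧ SortedFrom p.ivl.hi ps

/-- The parts are nonempty and divide the part of the line to the right of a cut. -/
def Tiles : Cut ℝ → List (Bool × Piece ℝ) → Prop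
  | c, [] => c.up = ∅
  | c, x :: xs => x.2.ivl.lo.up = c.up ∧ x.2.ivl.lo.lt x.2.ivl.hi ∧ Tiles x.2.ivl.hi xs

/-- `x` lies to the left of `y`. -/
def Ivl.before (x y : Ivl ℝ) : Prop := y.lo.up ⊆ x.hi.up

theorem Ivl.before.lt {x y : Ivl ℝ} (h : x.before y) {α β : ℝ} (hα : α ∈ x.toSet)
    (hβ : β ∈ y.toSet) : α < β := Cut.lt_of_mem hα.2 (h hβ.1)

theorem Tiles.cover {c : Cut ℝ} {L : List (Bool × Piece ℝ)} (h : Tiles c L) {α : ℝ}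
    (hα : α ∈ c.up) : ∃ x ∈ L, α ∈ x.2.ivl.toSet := by
  induction L generalizing c with
  | nil => rw [Tiles] at h; simp [h] at hα
  | cons x xs ih =>
    obtain ⟨h1, h2, h3⟩ := h
    by_cases hh : α ∈ x.2.ivl.hi.up
    · obtain ⟨y, hy, hα⟩ := ih h3 hh
      exact ⟨y, by simp [hy], hα⟩
    · exact ⟨x, by simp, h1.symm.subset hα, hh⟩

theorem Tiles.lo_subset {c : Cut ℝ} {L : List (Bool × Piece ℝ)} (h : Tiles c L) :
    ∀ x ∈ L, x.2.ivl.lo.up ⊆ c.up := by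
  induction L generalizing c with
  | nil => simp
  | cons x xs ih =>
    obtain ⟨h1, h2, h3⟩ := h
    intro y hy
    rcases List.mem_cons.1 hy with rfl | hy
    · exact h1.subset
    · exact (ih h3 y hy).trans (h1 ▸ h2.subset)

theorem Tiles.lt {c : Cut ℝ} {L : List (Bool × Piece ℝ)} (h : Tiles c L) :
    ∀ x ∈ L, x.2.ivl.lo.lt x.2.ivl.hi := by
  induction L generalizing c with
  | nil => simp
  | cons x xs ih =>
    obtain ⟨h1, h2, h3⟩ := h
    intro y hy
    rcases List.mem_cons.1 hy with rfl | hy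
    · exact h2
    · exact ih h3 y hy

theorem Tiles.pairwise {c : Cut ℝ} {L : List (Bool × Piece ℝ)} (h : Tiles c L) :
    L.Pairwise fun x y => x.2.ivl.before y.2.ivl := by
  induction L generalizing c with
  | nil => simp
  | cons x xs ih => exact List.pairwise_cons.2 ⟨h.2.2.lo_subset, ih h.2.2⟩

/-- What is known about the parts into which `truncate` divides the line: `N` is the set where the
new constant `c` is taken, and `K` a relation between the points of different pieces. -/
structure Parts (c : ℝ) (N : Set ℝ) (K : ℝ → ℝ → Prop) (ps : List (Piece ℝ)) (cur : Cut ℝ)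
    (L : List (Bool × Piece ℝ)) : Prop where
  tiles : Tiles cur L
  new : ∀ x ∈ L, x.1 = true → x.2.ivl.toSet ⊆ N ∧ x.2.a = 0 ∧ x.2.b = 0 ∧ x.2.d = c
  old : ∀ x ∈ L, x.1 = false → x.2.ivl.toSet ⊆ Nᶜ ∧
    ∃ p ∈ ps, x.2.ivl.toSet ⊆ p.ivl.toSet ∧ x.2.a = p.a ∧ x.2.b = p.b ∧ x.2.d = p.d
  sep : L.Pairwise fun x y => ∀ α ∈ x.2.ivl.toSet, ∀ γ ∈ y.2.ivl.toSet,
    (α ∈ N → γ ∈ N → ∃ β, α < β ∧ β < γ ∧ β ∉ N) ∧ (α ∉ N → γ ∉ N → K α γ)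

/-- Joining is what keeps `sep` true: two adjacent parts inside `N` would have no point outside `N`
between them. If the following part is old, it is nonempty and disjoint from `N`, and so separates
the new stretch from all later parts inside `N`. -/
theorem Parts.pushNew {c : ℝ} {N : Set ℝ} {K : ℝ → ℝ → Prop} {ps : List (Piece ℝ)} {lo hi : Cut ℝ}
    {L : List (Bool × Piece ℝ)} (h : Parts c N K ps hi L) (hsub : hi.up ⊆ lo.up)
    (hN : ∀ α ∈ lo.up, α ∉ hi.up → α ∈ N) :
    Parts c N K ps lo (val (pushNew c lo hi L)) := by
  simp only [FusedL0.pushNew, val_bind, val_ite, val_pure]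
  split_ifs with hlt <;> rw [val_cutLt] at hlt
  · have key : ∀ t : List (Bool × Piece ℝ), (∀ p t', t ≠ (true, p) :: t') → L = t →
        Parts c N K ps lo ((true, ⟨⟨lo, hi⟩, 0, 0, c⟩) :: L) := by
      rintro t ht rfl
      refine ⟨⟨rfl, hlt, h.tiles⟩, ?_, ?_, ?_⟩
      · intro x hx hx1
        rcases List.mem_cons.1 hx with rfl | hx
        · exact ⟨fun α hα => hN α hα.1 hα.2, rfl, rfl, rfl⟩
        · exact h.new x hx hx1
      · intro x hx hx1
        rcases List.mem_cons.1 hx with rfl | hx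
        · simp at hx1
        · exact h.old x hx hx1
      · refine List.pairwise_cons.2 ⟨?_, h.sep⟩
        intro y hy α hα γ hγ
        have hαN := hN α hα.1 hα.2
        refine ⟨fun _ hγN => ?_, fun hn => absurd hαN hn⟩
        rcases L with _ | ⟨⟨b, p⟩, t⟩
        · simp at hy
        · cases b with
          | true => exact absurd rfl (ht p t)
          | false =>
            have hpN := (h.old (false, p) (by simp) rfl).1
            obtain ⟨e1, e2, e3⟩ := h.tiles
            rcases List.mem_cons.1 hy with rfl | hy
            · exact absurd hγN (hpN hγ)
            -- Any point of the old head part serves as separator.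
            · obtain ⟨β, hβ⟩ := Ivl.nonempty_iff.2 e2
              refine ⟨β, Cut.lt_of_mem hα.2 (e1 ▸ hβ.1), ?_, hpN hβ⟩
              exact Cut.lt_of_mem hβ.2 (e3.lo_subset y hy hγ.1)
    rcases L with _ | ⟨⟨_ | _, p⟩, t⟩
    · simpa using key [] (by simp) rfl
    · simpa using key _ (by simp) rfl
    · obtain ⟨e1, e2, e3⟩ := h.tiles
      obtain ⟨hp1, hp2⟩ := h.new (true, p) (by simp) rfl
      have hp' : (⟨lo, p.ivl.hi⟩ : Ivl ℝ).toSet ⊆ N := by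
        intro α hα
        by_cases hh : α ∈ hi.up
        · exact hp1 ⟨e1.symm.subset hh, hα.2⟩
        · exact hN α hα.1 hh
      obtain ⟨s1, s2⟩ := List.pairwise_cons.1 h.sep
      obtain ⟨δ, hδ⟩ := Ivl.nonempty_iff.2 e2
      refine ⟨⟨rfl, ⟨δ, hsub (e1 ▸ hδ.1), hδ.2⟩, e3⟩, ?_, ?_, ?_⟩
      · intro x hx hx1
        rcases List.mem_cons.1 hx with rfl | hx
        · exact ⟨hp', hp2⟩
        · exact h.new x (by simp [hx]) hx1
      · intro x hx hx1
        rcases List.mem_cons.1 hx with rfl | hx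
        · simp at hx1
        · exact h.old x (by simp [hx]) hx1
      · refine List.pairwise_cons.2 ⟨?_, s2⟩
        intro y hy α hα γ hγ
        refine ⟨fun _ hγN => ?_, fun hn => absurd (hp' hα) hn⟩
        by_cases hh : α ∈ hi.up
        · have hα' : α ∈ p.ivl.toSet := ⟨e1.symm.subset hh, hα.2⟩
          exact (s1 y hy α hα' γ hγ).1 (hp1 hα') hγN
        -- In the added stretch, a separator found for a point `δ` of the absorbed part also works
        -- for `α`, which lies to the left of `δ`.
        · obtain ⟨β, b1, b2, b3⟩ := (s1 y hy δ hδ γ hγ).1 (hp1 hδ) hγN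
          exact ⟨β, (Cut.lt_of_mem hh (e1 ▸ hδ.1)).trans b1, b2, b3⟩
  · have : lo.up = hi.up := (Cut.not_lt_iff.1 hlt).antisymm hsub
    refine ⟨?_, h.new, h.old, h.sep⟩
    have ht := h.tiles
    cases L with
    | nil => exact this.trans ht
    | cons x xs => exact ⟨ht.1.trans this.symm, ht.2⟩

theorem Parts.mono {c : ℝ} {N : Set ℝ} {K : ℝ → ℝ → Prop} {ps ps' : List (Piece ℝ)} {cur : Cut ℝ}
    {L : List (Bool × Piece ℝ)} (h : Parts c N K ps cur L) (hps : ps ⊆ ps') :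
    Parts c N K ps' cur L :=
  ⟨h.tiles, h.new, fun x hx hx1 => by
    obtain ⟨h1, p, hp, h2⟩ := h.old x hx hx1
    exact ⟨h1, p, hps hp, h2⟩, h.sep⟩

theorem SortedFrom.lo_subset {c : Cut ℝ} {ps : List (Piece ℝ)} (h : SortedFrom c ps) :
    ∀ p ∈ ps, p.ivl.lo.up ⊆ c.up := by
  induction ps generalizing c with
  | nil => simp
  | cons p ps ih =>
    obtain ⟨h1, h2, h3⟩ := h
    intro q hq
    rcases List.mem_cons.1 hq with rfl | hq
    · exact h1
    · exact ((ih h3 q hq).trans h2.subset).trans h1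

theorem sortedFrom_of_pairwise {c : Cut ℝ} {ps : List (Piece ℝ)}
    (h : ps.Pairwise fun p q => p.ivl.before q.ivl) (h1 : ∀ p ∈ ps, p.ivl.lo.up ⊆ c.up)
    (h2 : ∀ p ∈ ps, p.ivl.lo.lt p.ivl.hi) : SortedFrom c ps := by
  induction ps generalizing c with
  | nil => trivial
  | cons p ps ih =>
    obtain ⟨a1, a2⟩ := List.pairwise_cons.1 h
    exact ⟨h1 p (by simp), h2 p (by simp), ih a2 a1 (fun q hq => h2 q (by simp [hq]))⟩

/-- Each piece yields at most one old part, its sublevel interval. Hence two old parts come from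
different pieces and inherit `K` from them. Gaps between pieces belong to `N` by `hN'`, the function
being infinite there. -/
theorem truncate_spec {c : ℝ} {N : Set ℝ} {K : ℝ → ℝ → Prop} {ps : List (Piece ℝ)} {cur : Cut ℝ}
    (hs : SortedFrom cur ps) (ha : ∀ p ∈ ps, 0 < p.a)
    (hN : ∀ p ∈ ps, ∀ α ∈ p.ivl.toSet, α ∈ N ↔ c ≤ p.quad α)
    (hN' : ∀ α ∈ cur.up, (∀ p ∈ ps, α ∉ p.ivl.toSet) → α ∈ N)
    (hK : ps.Pairwise fun p q => ∀ α ∈ p.ivl.toSet, ∀ γ ∈ q.ivl.toSet, K α γ) :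
    Parts c N K ps cur (val (truncate c cur ps)) := by
  induction ps generalizing cur with
  | nil =>
    simp only [truncate, val_bind]
    refine Parts.pushNew ⟨rfl, by simp, by simp, by simp⟩ (by simp) ?_
    intro α hα _
    exact hN' α hα (by simp)
  | cons p ps ih =>
    obtain ⟨h1, h2, h3⟩ := hs
    obtain ⟨k1, k2⟩ := List.pairwise_cons.1 hK
    have hrest : Parts c N K ps p.ivl.hi (val (truncate c p.ivl.hi ps)) := by
      refine ih h3 (fun q hq => ha q (by simp [hq])) (fun q hq => hN q (by simp [hq])) ?_ k2
      intro α hα hh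
      refine hN' α (h1 (h2.subset hα)) ?_
      intro q hq
      rcases List.mem_cons.1 hq with rfl | hq
      · exact fun hh => hh.2 hα
      · exact hh q hq
    have hcur : ∀ α ∈ cur.up, α ∉ p.ivl.lo.up → α ∈ N := by
      intro α hα hh
      refine hN' α hα ?_
      intro q hq
      rcases List.mem_cons.1 hq with rfl | hq
      · exact fun h => hh h.1
      · exact fun h => hh (h2.subset (h3.lo_subset q hq h.1))
    simp only [truncate, val_bind]
    rcases sublevel_spec c (ha p (by simp)) with ⟨e, hq⟩ | ⟨J, e, hJ, hlo, hhi, hq⟩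
    · rw [e]
      simp only [val_bind]
      refine Parts.pushNew (Parts.pushNew (hrest.mono (by simp)) h2.subset ?_) h1 hcur
      exact fun α hα hh => (hN p (by simp) α ⟨hα, hh⟩).2 (hq α ⟨hα, hh⟩)
    · rw [e]
      simp only [val_bind]
      obtain ⟨δ, hδ⟩ := Ivl.nonempty_iff.2 hJ
      have hJp : J.toSet ⊆ p.ivl.toSet := fun α hα => ⟨hlo hα.1, fun h => hα.2 (hhi h)⟩
      have hnew : ∀ α ∈ p.ivl.toSet, α ∉ J.toSet → α ∈ N := by
        intro α hα hh
        rw [hN p (by simp) α hα, ← not_lt, ← hq α hα]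
        exact hh
      refine Parts.pushNew (Parts.pushNew ?_ hlo ?_) h1 hcur
      · have hr : Parts c N K ps J.hi (val (pushNew c J.hi p.ivl.hi (val (truncate c p.ivl.hi ps)))) := by
          refine Parts.pushNew hrest hhi ?_
          intro α hα hh
          exact hnew α ⟨hlo (hJ.subset hα), hh⟩ (fun h => h.2 hα)
        have hJN : J.toSet ⊆ Nᶜ := by
          intro α hα hαN
          rw [hN p (by simp) α (hJp hα)] at hαN
          exact absurd hαN (not_le.2 ((hq α (hJp hα)).1 hα))
        have hr' := hr.mono (List.subset_cons_self p ps)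
        refine ⟨⟨rfl, hJ, hr.tiles⟩, ?_, ?_, ?_⟩
        · intro x hx hx1
          rcases List.mem_cons.1 hx with rfl | hx
          · simp at hx1
          · exact hr'.new x hx hx1
        · intro x hx hx1
          rcases List.mem_cons.1 hx with rfl | hx
          · exact ⟨hJN, p, by simp, hJp, rfl, rfl, rfl⟩
          · exact hr'.old x hx hx1
        · refine List.pairwise_cons.2 ⟨?_, hr.sep⟩
          rintro ⟨b, y⟩ hy α hα γ hγ
          refine ⟨fun h => absurd h (hJN hα), fun _ hγN => ?_⟩
          cases b with
          | true => exact absurd ((hr.new _ hy rfl).1 hγ) hγN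
          | false =>
            obtain ⟨_, q, hq, hsub, _⟩ := hr.old _ hy rfl
            exact k1 q hq α (hJp hα) γ (hsub hγ)
      · intro α hα hh
        have hlt : α < δ := Cut.lt_of_mem hh hδ.1
        refine hnew α ⟨hα, fun h => (hJp hδ).2 (p.ivl.hi.up_mono h hlt.le)⟩ (fun h => hh h.1)

/-! ### Adding a term -/

open Classical in
/-- The restriction of a piece to an interval, after adding `α²/2 - z α + e` to it. -/
noncomputable def restr (z e : ℝ) (J : Ivl ℝ) (p : Piece ℝ) : List (Piece ℝ) :=
  if (p.ivl.meet J).lo.lt (p.ivl.meet J).hi then [⟨p.ivl.meet J, p.a + 1 / 2, p.b - z, p.d + e⟩]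
  else []

theorem val_pushRestr (z e : ℝ) (J : Ivl ℝ) (p : Piece ℝ) (rest : List (Piece ℝ)) :
    val (pushRestr z e J p rest) = restr z e J p ++ rest := by
  simp only [pushRestr, val_bind, val_ivlMeet, val_ite, val_lit, val_addC, val_subC, val_pure, restr]
  split_ifs with h h' h' <;> rw [val_cutLt] at h <;> first | contradiction | simp

/-- The pieces that `addTerm` makes of one part. -/
noncomputable def split (lam2 z l u : ℝ) (p : Piece ℝ) : List (Piece ℝ) :=
  restr z (1 / 2 * (z * z) + lam2) ⟨.pt l false, .pt 0 false⟩ p ++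
    (restr z (1 / 2 * (z * z)) ⟨.pt 0 false, .pt 0 true⟩ p ++
      restr z (1 / 2 * (z * z) + lam2) ⟨.pt 0 true, .pt u true⟩ p)

theorem val_addTerm (lam2 z l u : ℝ) (L : List (Bool × Piece ℝ)) :
    val (addTerm lam2 z l u L) = L.flatMap fun x => split lam2 z l u x.2 := by
  induction L with
  | nil => simp [addTerm]
  | cons x xs ih =>
    obtain ⟨b, p⟩ := x
    simp only [addTerm, val_bind, val_pushRestr, val_lit, val_mulC, val_addC, ih, List.flatMap_cons,
      split]
    push_cast
    simp [List.append_assoc]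


/-! ### The functions and sets of the recursion -/

section Theory

variable {n : ℕ} {lam1 lam2 : ℝ} {z l u : Fin n → ℝ}

theorem entry_nonpos (hl : ∀ i, l i ≤ 0) (s : ℕ) : entry l s ≤ 0 := by
  unfold entry; split_ifs
  · exact hl _
  · exact le_rfl

theorem entry_nonneg (hu : ∀ i, 0 ≤ u i) (s : ℕ) : 0 ≤ entry u s := by
  unfold entry; split_ifs
  · exact hu _
  · exact le_rfl

/-- The summand `(α - z_s)²/2 + ω_s(α)`. -/
noncomputable def term (lam2 : ℝ) (z l u : Fin n → ℝ) (s : ℕ) (α : ℝ) : EReal :=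
  ((1 / 2 * (α - entry z s) ^ 2 : ℝ) : EReal) + omega lam2 (entry l s) (entry u s) α

/-- The real value of `term` in the box. -/
noncomputable def termR (lam2 : ℝ) (z : Fin n → ℝ) (s : ℕ) (α : ℝ) : ℝ :=
  1 / 2 * (α - entry z s) ^ 2 + if α = 0 then 0 else lam2

theorem term_of_mem {s : ℕ} {α : ℝ} (h : α ∈ Set.Icc (entry l s) (entry u s)) :
    term lam2 z l u s α = (termR lam2 z s α : ℝ) := by
  simp only [term, omega, delta, h, if_true, add_zero, termR]
  exact (EReal.coe_add _ _).symm

theorem term_of_notMem {s : ℕ} {α : ℝ} (h : α ∉ Set.Icc (entry l s) (entry u s)) :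
    term lam2 z l u s α = ⊤ := by
  simp only [term, omega, delta, h, if_false]
  rw [EReal.coe_add_top, EReal.coe_add_top]

theorem termR_nonneg (h2 : 0 < lam2) (s : ℕ) (α : ℝ) : 0 ≤ termR lam2 z s α := by
  unfold termR; split_ifs <;> positivity

theorem term_nonneg (h2 : 0 < lam2) (s : ℕ) (α : ℝ) : 0 ≤ term lam2 z l u s α := by
  by_cases h : α ∈ Set.Icc (entry l s) (entry u s)
  · rw [term_of_mem h]; exact_mod_cast termR_nonneg h2 s α
  · rw [term_of_notMem h]; exact le_top

/-- The threshold `min P_s^* + λ₁`. -/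
noncomputable def level (lam1 lam2 : ℝ) (z l u : Fin n → ℝ) (s : ℕ) : EReal :=
  (⨅ α : ℝ, Pstar lam1 lam2 z l u s α) + (lam1 : EReal)

theorem Pstar_one (α : ℝ) : Pstar lam1 lam2 z l u 1 α = term lam2 z l u 1 α := by
  simp only [Pstar, term]
  rw [show (entry z 1 - α) ^ 2 = (α - entry z 1) ^ 2 by ring]

theorem Pstar_succ {s : ℕ} (hs : 1 ≤ s) (α : ℝ) : Pstar lam1 lam2 z l u (s + 1) α =
    min (Pstar lam1 lam2 z l u s α) (level lam1 lam2 z l u s) + term lam2 z l u (s + 1) α := by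
  obtain ⟨t, rfl⟩ : ∃ t, s = t + 1 := ⟨s - 1, by omega⟩
  simp only [Pstar, term, level, add_assoc]

theorem Pstar_nonneg (h1 : 0 < lam1) (h2 : 0 < lam2) (s : ℕ) (α : ℝ) :
    0 ≤ Pstar lam1 lam2 z l u s α := by
  induction s generalizing α with
  | zero => exact le_rfl
  | succ s ih =>
    rcases Nat.eq_zero_or_pos s with rfl | hs
    · rw [Pstar_one]; exact term_nonneg h2 _ _
    · rw [Pstar_succ hs]
      refine add_nonneg (le_min (ih α) ?_) (term_nonneg h2 _ _)
      exact add_nonneg (le_iInf ih) (by exact_mod_cast h1.le)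

theorem Pstar_ne_bot (h1 : 0 < lam1) (h2 : 0 < lam2) (s : ℕ) (α : ℝ) :
    Pstar lam1 lam2 z l u s α ≠ ⊥ :=
  ((EReal.bot_lt_zero).trans_le (Pstar_nonneg h1 h2 s α)).ne'

theorem iInf_Pstar_real (h1 : 0 < lam1) (h2 : 0 < lam2) {s : ℕ}
    (h0 : Pstar lam1 lam2 z l u s 0 ≠ ⊤) :
    ∃ m : ℝ, (⨅ α : ℝ, Pstar lam1 lam2 z l u s α) = m := by
  refine ⟨_, (EReal.coe_toReal ?_ ?_).symm⟩
  · exact ((iInf_le _ (0 : ℝ)).trans_lt h0.lt_top).ne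
  · exact (EReal.bot_lt_zero.trans_le (le_iInf (Pstar_nonneg h1 h2 s))).ne'

/-- The sign conditions put `0` into every box. This makes all thresholds real numbers. -/
theorem Pstar_zero_ne_top (hl : ∀ i, l i ≤ 0) (hu : ∀ i, 0 ≤ u i) (s : ℕ) : Pstar lam1 lam2 z l u s 0 ≠ ⊤ := by
  have hmem : ∀ t, (0 : ℝ) ∈ Set.Icc (entry l t) (entry u t) :=
    fun t => ⟨entry_nonpos hl t, entry_nonneg hu t⟩
  induction s with
  | zero => exact EReal.zero_ne_top
  | succ s ih =>
    rcases Nat.eq_zero_or_pos s with rfl | hs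
    · rw [Pstar_one, term_of_mem (hmem 1)]; exact EReal.coe_ne_top _
    · rw [Pstar_succ hs, term_of_mem (hmem _)]
      exact (EReal.add_lt_top ((min_le_left _ _).trans_lt ih.lt_top).ne (EReal.coe_ne_top _)).ne

theorem exists_level (h1 : 0 < lam1) (h2 : 0 < lam2) (hl : ∀ i, l i ≤ 0) (hu : ∀ i, 0 ≤ u i)
    (s : ℕ) : ∃ c : ℝ, level lam1 lam2 z l u s = c := by
  obtain ⟨m, hm⟩ := iInf_Pstar_real (z := z) h1 h2 (Pstar_zero_ne_top hl hu s)
  exact ⟨m + lam1, by rw [level, hm]; exact (EReal.coe_add _ _).symm⟩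

/-- The real threshold caps the earlier function, so only the last box restricts the domain. In
particular the domain is an interval. -/
theorem Pstar_ne_top_iff (h1 : 0 < lam1) (h2 : 0 < lam2) (hl : ∀ i, l i ≤ 0) (hu : ∀ i, 0 ≤ u i)
    {s : ℕ} (hs : 1 ≤ s) (α : ℝ) :
    Pstar lam1 lam2 z l u s α ≠ ⊤ ↔ α ∈ Set.Icc (entry l s) (entry u s) := by
  obtain ⟨t, rfl⟩ : ∃ t, s = t + 1 := ⟨s - 1, by omega⟩
  rcases Nat.eq_zero_or_pos t with rfl | ht
  · rw [Pstar_one]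
    by_cases h : α ∈ Set.Icc (entry l (0 + 1)) (entry u (0 + 1))
    · simp only [h, iff_true]; rw [term_of_mem h]; exact EReal.coe_ne_top _
    · simp only [h, iff_false, not_not]; exact term_of_notMem h
  · rw [Pstar_succ ht]
    obtain ⟨c, hc⟩ := exists_level (z := z) h1 h2 hl hu t
    by_cases h : α ∈ Set.Icc (entry l (t + 1)) (entry u (t + 1))
    · simp only [h, iff_true]; rw [term_of_mem h, hc]
      exact (EReal.add_lt_top ((min_le_right _ _).trans_lt (EReal.coe_lt_top _)).ne
        (EReal.coe_ne_top _)).ne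
    · simp only [h, iff_false, not_not]; rw [term_of_notMem h]
      refine EReal.add_top_of_ne_bot (ne_of_gt (lt_min ?_ ?_))
      · exact (Pstar_ne_bot h1 h2 t α).bot_lt
      · rw [hc]; exact EReal.bot_lt_coe _

theorem mem_newSet {s : ℕ} {α : ℝ} : α ∈ newSet lam1 lam2 z l u (s + 1) ↔
    level lam1 lam2 z l u s ≤ Pstar lam1 lam2 z l u s α := Iff.rfl

theorem Rset_self {s : ℕ} (hs : 1 ≤ s) :
    Rset lam1 lam2 z l u (s + 1) s = newSet lam1 lam2 z l u (s + 1) := by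
  obtain ⟨t, rfl⟩ : ∃ t, s = t + 1 := ⟨s - 1, by omega⟩
  simp [Rset]

theorem Rset_of_ne {s i : ℕ} (hs : 1 ≤ s) (hi : i ≠ s) : Rset lam1 lam2 z l u (s + 1) i =
    Rset lam1 lam2 z l u s i ∩ (newSet lam1 lam2 z l u (s + 1))ᶜ := by
  obtain ⟨t, rfl⟩ : ∃ t, s = t + 1 := ⟨s - 1, by omega⟩
  simp [Rset, hi]

theorem exists_mem_Rset {s : ℕ} (hs : 1 ≤ s) (α : ℝ) : ∃ i < s, α ∈ Rset lam1 lam2 z l u s i := by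
  induction s, hs using Nat.le_induction with
  | base => exact ⟨0, by simp, by simp [Rset]⟩
  | succ s hs ih =>
    by_cases h : α ∈ newSet lam1 lam2 z l u (s + 1)
    · exact ⟨s, by omega, by rw [Rset_self hs]; exact h⟩
    · obtain ⟨i, hi, hα⟩ := ih
      exact ⟨i, by omega, by rw [Rset_of_ne hs hi.ne]; exact ⟨hα, h⟩⟩

theorem Rset_subset {i t s : ℕ} (hi : i < t) (hts : t ≤ s) :
    Rset lam1 lam2 z l u s i ⊆ Rset lam1 lam2 z l u t i := by
  induction s, hts using Nat.le_induction with
  | base => exact subset_rfl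
  | succ s hs ih =>
    rw [Rset_of_ne (by omega) (by omega)]
    exact Set.inter_subset_left.trans ih

/-! #### The quadratics from which the functions are made -/

/-- The function that starts from the threshold at `i`, after `k` steps without a new start. -/
noncomputable def branch (lam1 lam2 : ℝ) (z l u : Fin n → ℝ) (i : ℕ) : ℕ → ℝ → EReal
  | 0 => fun _ => if i = 0 then 0 else level lam1 lam2 z l u i
  | k + 1 => fun α => branch lam1 lam2 z l u i k α + term lam2 z l u (i + k + 1) α

/-- A branch makes one particular choice in each minimum: the threshold at `i`, the other
alternative afterwards. `Pstar_eq_branch` adds that on `R_s^i` these choices are the minimizing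
ones. -/
theorem Pstar_le_branch (i k : ℕ) (α : ℝ) :
    Pstar lam1 lam2 z l u (i + k + 1) α ≤ branch lam1 lam2 z l u i (k + 1) α := by
  induction k with
  | zero =>
    rcases Nat.eq_zero_or_pos i with rfl | hi
    · simp [branch, Pstar_one]
    · simp only [branch, hi.ne', if_false, add_zero]
      rw [Pstar_succ hi]
      exact add_le_add_left (min_le_right _ _) _
  | succ k ih =>
    rw [show i + (k + 1) + 1 = (i + k + 1) + 1 by ring, Pstar_succ (by omega), branch]
    exact add_le_add_left ((min_le_left _ _).trans ih) _

theorem Pstar_eq_branch {i k : ℕ} {α : ℝ} (h : α ∈ Rset lam1 lam2 z l u (i + k + 1) i) :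
    Pstar lam1 lam2 z l u (i + k + 1) α = branch lam1 lam2 z l u i (k + 1) α := by
  induction k with
  | zero =>
    rcases Nat.eq_zero_or_pos i with rfl | hi
    · simp [branch, Pstar_one]
    · simp only [branch, hi.ne', if_false, add_zero]
      rw [add_zero, Rset_self hi] at h
      rw [Pstar_succ hi, min_eq_right (mem_newSet.1 h)]
  | succ k ih =>
    rw [show i + (k + 1) + 1 = (i + k + 1) + 1 by ring] at h ⊢
    rw [Rset_of_ne (by omega) (by omega)] at h
    rw [Pstar_succ (by omega), branch, min_eq_left (not_le.1 (fun hh => h.2 (mem_newSet.2 hh))).le,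
      ih h.1]
    rfl

/-- Off `0`, the function is a convex quadratic on an interval, and infinite elsewhere. -/
def IsConvexQuad (f : ℝ → EReal) : Prop :=
  ∃ (a b d : ℝ) (D : Set ℝ), 0 ≤ a ∧ D.OrdConnected ∧ ∀ α ≠ 0,
    (α ∈ D → f α = ((a * α ^ 2 + b * α + d : ℝ) : EReal)) ∧ (α ∉ D → f α = ⊤)

theorem isConvexQuad_branch (h1 : 0 < lam1) (h2 : 0 < lam2) (hl : ∀ i, l i ≤ 0)
    (hu : ∀ i, 0 ≤ u i) (i k : ℕ) : IsConvexQuad (branch lam1 lam2 z l u i k) := by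
  induction k with
  | zero =>
    obtain ⟨c, hc⟩ := exists_level (z := z) h1 h2 hl hu i
    refine ⟨0, 0, if i = 0 then 0 else c, Set.univ, le_rfl, Set.ordConnected_univ, fun α _ => ?_⟩
    simp only [branch, hc]
    split_ifs <;> simp
  | succ k ih =>
    obtain ⟨a, b, d, D, ha, hD, hf⟩ := ih
    set w := entry z (i + k + 1)
    refine ⟨a + 1 / 2, b - w, d + 1 / 2 * w ^ 2 + lam2,
      D ∩ Set.Icc (entry l (i + k + 1)) (entry u (i + k + 1)), by positivity,
      hD.inter Set.ordConnected_Icc, fun α hα => ⟨?_, ?_⟩⟩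
    · rintro ⟨m1, m2⟩
      simp only [branch]
      rw [(hf α hα).1 m1, term_of_mem m2, ← EReal.coe_add, termR, if_neg hα]
      congr 1; ring
    · intro hm
      simp only [branch]
      by_cases m1 : α ∈ D
      · have m2 : α ∉ Set.Icc (entry l (i + k + 1)) (entry u (i + k + 1)) := fun h => hm ⟨m1, h⟩
        rw [(hf α hα).1 m1, term_of_notMem m2, EReal.coe_add_top]
      · rw [(hf α hα).2 m1]
        refine EReal.top_add_of_ne_bot ?_
        exact (EReal.bot_lt_zero.trans_le (term_nonneg h2 _ _)).ne'

/-- Convexity of one quadratic on an interval. The points may lie on different sides of `0`, since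
the same coefficients are valid on both. -/
theorem IsConvexQuad.lt_of_between {f : ℝ → EReal} (hf : IsConvexQuad f) {c : EReal} {α β γ : ℝ}
    (h1 : α < β) (h2 : β < γ) (hα : α ≠ 0) (hβ : β ≠ 0) (hγ : γ ≠ 0) (hfα : f α < c)
    (hfγ : f γ < c) : f β < c := by
  obtain ⟨a, b, d, D, ha, hD, hf⟩ := hf
  have hαD : α ∈ D := by
    by_contra h
    rw [(hf α hα).2 h] at hfα
    exact not_top_lt hfα
  have hγD : γ ∈ D := by
    by_contra h
    rw [(hf γ hγ).2 h] at hfγ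
    exact not_top_lt hfγ
  have hβD : β ∈ D := hD.out hαD hγD ⟨h1.le, h2.le⟩
  rw [(hf _ hα).1 hαD] at hfα
  rw [(hf _ hγ).1 hγD] at hfγ
  rw [(hf _ hβ).1 hβD]
  -- Otherwise the chord from `α` to `β` has positive slope `a (β + α) + b` and the chord from `β`
  -- to `γ` negative slope `a (γ + β) + b`, contrary to `0 ≤ a`.
  have key : a * β ^ 2 + b * β + d ≤ a * α ^ 2 + b * α + d ∨
      a * β ^ 2 + b * β + d ≤ a * γ ^ 2 + b * γ + d := by
    by_contra! h
    obtain ⟨k1, k2⟩ := h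
    have e1 : 0 < (β - α) * (a * (β + α) + b) := by linarith
    have e2 : (γ - β) * (a * (γ + β) + b) < 0 := by linarith
    have f1 : 0 < a * (β + α) + b := pos_of_mul_pos_right e1 (by linarith)
    have f2 : a * (γ + β) + b < 0 := neg_of_mul_neg_right e2 (by linarith)
    nlinarith
  rcases key with h | h
  · exact (EReal.coe_le_coe_iff.2 h).trans_lt hfα
  · exact (EReal.coe_le_coe_iff.2 h).trans_lt hfγ

/-- All three memberships are pulled back to stage `j + 1`, where `j` is the newest label. There the
`i`-points are strictly below the threshold of stage `j` along one branch, while `β` is not below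
it. Convexity of the branch and `Pstar_le_branch` make these incompatible. -/
theorem Rset_not_interlaced (h1 : 0 < lam1) (h2 : 0 < lam2) (hl : ∀ i, l i ≤ 0)
    (hu : ∀ i, 0 ≤ u i) {s i j : ℕ} (hij : i < j) (hj : j < s) {α β γ : ℝ} (hα : α ≠ 0)
    (hβ : β ≠ 0) (hγ : γ ≠ 0) (hαβ : α < β) (hβγ : β < γ) (mα : α ∈ Rset lam1 lam2 z l u s i)
    (mβ : β ∈ Rset lam1 lam2 z l u s j) (mγ : γ ∈ Rset lam1 lam2 z l u s i) : False := by
  have nβ := Rset_subset (Nat.lt_succ_self j) hj mβ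
  rw [Rset_self (by omega), mem_newSet] at nβ
  obtain ⟨k, rfl⟩ : ∃ k, j = i + k + 1 := ⟨j - i - 1, by omega⟩
  have aux : ∀ x ∈ Rset lam1 lam2 z l u s i,
      branch lam1 lam2 z l u i (k + 1) x < level lam1 lam2 z l u (i + k + 1) := by
    intro x hx
    have hx := Rset_subset (show i < i + k + 1 + 1 by omega) hj hx
    rw [Rset_of_ne (by omega) (by omega)] at hx
    rw [← Pstar_eq_branch hx.1]
    exact not_le.1 hx.2
  have := (isConvexQuad_branch (z := z) h1 h2 hl hu i (k + 1)).lt_of_between hαβ hβγ hα hβ hγ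
    (aux α mα) (aux γ mγ)
  exact absurd (nβ.trans (Pstar_le_branch i k β)) (not_le.2 this)

/-! #### Lower semicontinuity -/

theorem lowerSemicontinuous_term (h2 : 0 < lam2) (s : ℕ) :
    LowerSemicontinuous (term lam2 z l u s) := by
  -- A minorant near `x` that is continuous at `x` and touches there suffices. At `0` it omits `λ₂`;
  -- at other points of the box it includes it.
  have key : ∀ (x : ℝ) (g : ℝ → ℝ), ContinuousAt g x → term lam2 z l u s x = (g x : ℝ) →
      (∀ᶠ x' in 𝓝 x, ((g x' : ℝ) : EReal) ≤ term lam2 z l u s x') →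
      LowerSemicontinuousAt (term lam2 z l u s) x := by
    intro x g hg hx hle y hy
    rw [hx] at hy
    have : ContinuousAt (fun x' => ((g x' : ℝ) : EReal)) x :=
      continuous_coe_real_ereal.continuousAt.comp hg
    filter_upwards [hle, this.eventually (lt_mem_nhds hy)] with x' h1 h2
    exact h2.trans_le h1
  intro x
  by_cases hx : x ∈ Set.Icc (entry l s) (entry u s)
  · by_cases h0 : x = 0
    · refine key x (fun x' => 1 / 2 * (x' - entry z s) ^ 2) (by fun_prop) ?_ (.of_forall ?_)
      · rw [term_of_mem hx, termR, if_pos h0, add_zero]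
      · intro x'
        by_cases hx' : x' ∈ Set.Icc (entry l s) (entry u s)
        · rw [term_of_mem hx', termR]
          refine EReal.coe_le_coe_iff.2 ?_
          split_ifs <;> linarith
        · rw [term_of_notMem hx']; exact le_top
    · refine key x (fun x' => 1 / 2 * (x' - entry z s) ^ 2 + lam2) (by fun_prop) ?_ ?_
      · rw [term_of_mem hx, termR, if_neg h0]
      · filter_upwards [isOpen_ne.mem_nhds h0] with x' h0'
        by_cases hx' : x' ∈ Set.Icc (entry l s) (entry u s)
        · rw [term_of_mem hx', termR, if_neg h0']
        · rw [term_of_notMem hx']; exact le_top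
  · intro y hy
    filter_upwards [isClosed_Icc.isOpen_compl.mem_nhds hx] with x' hx'
    rw [term_of_notMem hx] at hy
    rwa [term_of_notMem hx']

theorem lowerSemicontinuous_Pstar (h1 : 0 < lam1) (h2 : 0 < lam2) (hl : ∀ i, l i ≤ 0)
    (hu : ∀ i, 0 ≤ u i) (s : ℕ) : LowerSemicontinuous (Pstar lam1 lam2 z l u s) := by
  induction s with
  | zero => exact lowerSemicontinuous_const
  | succ s ih =>
    rcases Nat.eq_zero_or_pos s with rfl | hs
    · have : Pstar lam1 lam2 z l u (0 + 1) = term lam2 z l u 1 := funext fun α => Pstar_one α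
      rw [this]
      exact lowerSemicontinuous_term h2 1
    · have : Pstar lam1 lam2 z l u (s + 1) = fun α =>
          min (Pstar lam1 lam2 z l u s α) (level lam1 lam2 z l u s) + term lam2 z l u (s + 1) α :=
        funext fun α => Pstar_succ hs α
      rw [this]
      obtain ⟨c, hc⟩ := exists_level (z := z) h1 h2 hl hu s
      refine LowerSemicontinuous.add' (ih.inf lowerSemicontinuous_const)
        (lowerSemicontinuous_term h2 (s + 1)) ?_
      intro x
      refine EReal.continuousAt_add (Or.inr ?_) (Or.inl ?_)
      · exact (EReal.bot_lt_zero.trans_le (term_nonneg h2 _ _)).ne'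
      · refine ne_of_gt (lt_min (Pstar_ne_bot h1 h2 s x).bot_lt ?_)
        rw [hc]; exact EReal.bot_lt_coe _

/-- At a limit of points of `A` a lower semicontinuous function can only drop below the continuous
quadratic. This turns a minimizer on the closure of a piece into a minimizer of the function itself,
even if the end is excluded from the piece. -/
theorem le_quad_of_mem_closure {f : ℝ → EReal} (hf : LowerSemicontinuous f) {A : Set ℝ} {p : Piece ℝ}
    (hA : ∀ α ∈ A, f α = (p.quad α : ℝ)) {v : ℝ} (hv : v ∈ closure A) :
    f v ≤ (p.quad v : ℝ) := by
  by_contra! h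
  obtain ⟨y, hy1, hy2⟩ := exists_between h
  have hc : ContinuousAt (fun x' => ((p.quad x' : ℝ) : EReal)) v :=
    continuous_coe_real_ereal.continuousAt.comp (by unfold Piece.quad; fun_prop)
  obtain ⟨x, hxA, hx1, hx2⟩ := ((mem_closure_iff_frequently.1 hv).and_eventually
    ((hf v y hy2).and (hc.eventually (gt_mem_nhds hy1)))).exists
  rw [hA x hxA] at hx1
  exact absurd hx1 hx2.not_gt

end Theory

/-! ### Sequences without interlacing -/

/-- The smallest letter `t` occurs at most once: between two occurrences there would be a larger
letter. Deleting it creates at most one pair of equal neighbours, and deleting one of that pair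
restores the hypotheses. So each letter of the alphabet costs at most two entries. -/
theorem length_le_of_not_interlaced (k t : ℕ) (L : List ℕ) (hL : ∀ x ∈ L, t ≤ x ∧ x < t + k)
    (hc : L.IsChain (· ≠ ·)) (hi : ∀ a b, a < b → ¬ List.Sublist [a, b, a] L) :
    L.length ≤ 2 * k := by
  induction k generalizing t L with
  | zero =>
    cases L with
    | nil => simp
    | cons x xs => have := hL x (by simp); omega
  | succ k ih =>
    have step : ∀ M : List ℕ, t ∉ M → List.Sublist M L → M.IsChain (· ≠ ·) → M.length ≤ 2 * k := by
      intro M hM hML hMc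
      refine ih (t + 1) M (fun x hx => ?_) hMc (fun a b hab h => hi a b hab (h.trans hML))
      have := hL x (hML.subset hx)
      have : x ≠ t := fun h => hM (h ▸ hx)
      omega
    by_cases ht : t ∈ L
    · obtain ⟨A, B, rfl, hA⟩ := List.eq_append_cons_of_mem ht
      obtain ⟨c1, c2, -⟩ := List.isChain_append.1 hc
      have hB : t ∉ B := by
        intro hB
        cases B with
        | nil => simp at hB
        | cons b B =>
          -- The neighbour `b` of the first `t` is larger, so a second `t` would give the forbidden
          -- `t b t`.
          have hne : t ≠ b := (List.isChain_cons_cons.1 c2).1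
          have hb := hL b (by simp)
          have hB : t ∈ B := (List.mem_cons.1 hB).resolve_left hne
          refine hi t b (by omega) ?_
          refine List.Sublist.trans ?_ (List.sublist_append_right A _)
          exact ((List.singleton_sublist.2 hB).cons_cons b).cons_cons t
      cases B with
      | nil =>
        have := step A hA (by simp) c1
        simp; omega
      | cons b B =>
        have hbB := (List.isChain_cons_cons.1 c2).2
        simp only [List.mem_cons, not_or] at hB
        -- If the letters around `t` coincide, one copy of `b` is removed together with `t`.
        by_cases hj : b ∈ A.getLast?
        · have hc' : (A ++ B).IsChain (· ≠ ·) := by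
            refine List.isChain_append.2 ⟨c1, hbB.tail, ?_⟩
            intro x hx y hy
            obtain rfl : b = x := Option.mem_unique hj hx
            cases B with
            | nil => simp at hy
            | cons y' B =>
              simp only [List.head?_cons, Option.mem_def, Option.some.injEq] at hy
              exact hy ▸ (List.isChain_cons_cons.1 hbB).1
          have := step (A ++ B) (by simp [hA, hB]) (by
            refine (List.Sublist.refl A).append ?_
            exact (List.sublist_cons_self _ _).trans (List.sublist_cons_self _ _)) hc'
          simp at this ⊢; omega
        · have hc' : (A ++ b :: B).IsChain (· ≠ ·) := by
            refine List.isChain_append.2 ⟨c1, hbB, ?_⟩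
            intro x hx y hy
            simp only [List.head?_cons, Option.mem_def, Option.some.injEq] at hy
            rintro rfl
            exact hj (hy ▸ hx)
          have := step (A ++ b :: B) (by simp [hA, hB])
            ((List.Sublist.refl A).append (List.sublist_cons_self _ _)) hc'
          simp at this ⊢; omega
    · have := step L ht (List.Sublist.refl L) hc
      omega

/-- The number of pieces in a list whose members lie, from left to right, in the sets of a
family which do not interlace. -/
theorem length_le_of_sets (R : ℕ → Set ℝ) (s : ℕ) (L : List (Piece ℝ))
    (hne : ∀ p ∈ L, p.ivl.lo.lt p.ivl.hi) (hord : L.Pairwise fun p q => p.ivl.before q.ivl)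
    (hsep : L.Pairwise fun p q => ∀ α ∈ p.ivl.toSet, ∀ γ ∈ q.ivl.toSet, ∀ i, α ∈ R i → γ ∈ R i →
      ∃ β, α < β ∧ β < γ ∧ β ∉ R i)
    (hR : ∀ p ∈ L, ∃ i < s, p.ivl.toSet ⊆ R i)
    (hconv : ∀ p ∈ L, ∀ q ∈ L, ∀ α ∈ p.ivl.toSet, ∀ γ ∈ q.ivl.toSet, ∀ β, α < β → β < γ →
      ∃ r ∈ L, β ∈ r.ivl.toSet)
    (hint : ∀ i j, i < j → j < s → ∀ p ∈ L, ∀ q ∈ L, ∀ r ∈ L, ∀ α ∈ p.ivl.toSet,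
      ∀ β ∈ q.ivl.toSet, ∀ γ ∈ r.ivl.toSet, α < β → β < γ → α ∈ R i → β ∈ R j → γ ∈ R i → False) :
    L.length ≤ 2 * s := by
  choose! lab hlab hsub using hR
  rw [← List.length_map (f := lab)]
  refine length_le_of_not_interlaced s 0 (L.map lab) ?_ ?_ ?_
  · intro x hx
    obtain ⟨p, hp, rfl⟩ := List.mem_map.1 hx
    have := hlab p hp
    omega
  · rw [List.isChain_map, List.isChain_iff_forall_rel_of_append_cons_cons]
    rintro p q A B rfl heq
    obtain ⟨-, o1, o2⟩ := List.pairwise_append.1 hord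
    obtain ⟨o3, o4⟩ := List.pairwise_cons.1 o1
    obtain ⟨o5, -⟩ := List.pairwise_cons.1 o4
    obtain ⟨-, s1, -⟩ := List.pairwise_append.1 hsep
    obtain ⟨s2, -⟩ := List.pairwise_cons.1 s1
    obtain ⟨α, hα⟩ := Ivl.nonempty_iff.2 (hne p (by simp))
    obtain ⟨γ, hγ⟩ := Ivl.nonempty_iff.2 (hne q (by simp))
    have hαγ := (o3 q (by simp)).lt hα hγ
    -- If neighbours `p`, `q` had the same label, the separating point `β` would lie in some piece.
    -- The order leaves only `p` and `q`, which are both inside the labelled set.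
    obtain ⟨β, hβ1, hβ2, hβ⟩ := s2 q (by simp) α hα γ hγ (lab p) (hsub p (by simp) hα)
      (heq ▸ hsub q (by simp) hγ)
    obtain ⟨r, hr, hβr⟩ := hconv p (by simp) q (by simp) α hα γ hγ β hβ1 hβ2
    have hr' : r ∈ A ∨ r = p ∨ r = q ∨ r ∈ B := by simpa using hr
    rcases hr' with h | rfl | rfl | h
    · exact absurd ((o2 r h p (by simp)).lt hβr hα) hβ1.not_gt
    · exact hβ (hsub r (by simp) hβr)
    · exact hβ (heq ▸ hsub r (by simp) hβr)
    · exact absurd ((o5 r h).lt hγ hβr) hβ2.not_gt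
  · intro a b hab h
    obtain ⟨M, hM, hMe⟩ := List.sublist_map_iff.1 h
    obtain ⟨p, M, rfl⟩ : ∃ p M', M = p :: M' := by cases M <;> simp_all
    obtain ⟨q, M, rfl⟩ : ∃ p M', M = p :: M' := by cases M <;> simp_all
    obtain ⟨r, M, rfl⟩ : ∃ p M', M = p :: M' := by cases M <;> simp_all
    simp only [List.map_cons, List.cons.injEq] at hMe
    obtain ⟨e1, e2, e3, -⟩ := hMe
    have hp := hM.subset (show p ∈ _ by simp)
    have hq := hM.subset (show q ∈ _ by simp)
    have hr := hM.subset (show r ∈ _ by simp)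
    have o := hord.sublist hM
    simp only [List.pairwise_cons, List.mem_cons, forall_eq_or_imp] at o
    obtain ⟨⟨o1, -⟩, ⟨o2, -⟩, -⟩ := o
    obtain ⟨α, hα⟩ := Ivl.nonempty_iff.2 (hne p hp)
    obtain ⟨β, hβ⟩ := Ivl.nonempty_iff.2 (hne q hq)
    obtain ⟨γ, hγ⟩ := Ivl.nonempty_iff.2 (hne r hr)
    refine hint a b hab (e2 ▸ hlab q hq) p hp q hq r hr α hα β hβ γ hγ (o1.lt hα hβ) (o2.lt hβ hγ)
      (e1 ▸ hsub p hp hα) (e2 ▸ hsub q hq hβ) (e3 ▸ hsub r hr hγ)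


/-! ### The pieces made by `addTerm` -/

theorem mem_restr {z e : ℝ} {J : Ivl ℝ} {p q : Piece ℝ} : q ∈ restr z e J p ↔
    (p.ivl.meet J).lo.lt (p.ivl.meet J).hi ∧
      q = ⟨p.ivl.meet J, p.a + 1 / 2, p.b - z, p.d + e⟩ := by
  unfold restr
  split_ifs with h <;> simp [h]

theorem restr_pairwise {z e : ℝ} {J : Ivl ℝ} {p : Piece ℝ} (r : Piece ℝ → Piece ℝ → Prop) :
    (restr z e J p).Pairwise r := by
  unfold restr
  split_ifs <;> simp

theorem split_before {lam2 z l u : ℝ} {p q : Piece ℝ} (hq : q ∈ split lam2 z l u p) :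
    q.ivl.lo.lt q.ivl.hi ∧ q.a = p.a + 1 / 2 ∧ q.ivl.lo.up ⊆ p.ivl.lo.up ∧
      p.ivl.hi.up ⊆ q.ivl.hi.up := by
  simp only [split, List.mem_append, mem_restr] at hq
  rcases hq with ⟨h, rfl⟩ | ⟨h, rfl⟩ | ⟨h, rfl⟩ <;>
    exact ⟨h, rfl, by rw [Ivl.up_meet_lo]; exact Set.inter_subset_left,
      by rw [Ivl.up_meet_hi]; exact Set.subset_union_left⟩

theorem split_toSet {lam2 z l u : ℝ} {p q : Piece ℝ} (hq : q ∈ split lam2 z l u p) :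
    q.ivl.toSet ⊆ p.ivl.toSet := by
  obtain ⟨-, -, h1, h2⟩ := split_before hq
  exact fun α hα => ⟨h1 hα.1, fun h => hα.2 (h2 h)⟩

theorem split_quad {lam2 z l u : ℝ} (hl : l ≤ 0) (hu : 0 ≤ u) {p q : Piece ℝ}
    (hq : q ∈ split lam2 z l u p) : ∀ α ∈ q.ivl.toSet, α ∈ Set.Icc l u ∧
      q.quad α = p.quad α + (1 / 2 * (α - z) ^ 2 + if α = 0 then 0 else lam2) := by
  intro α hα
  simp only [split, List.mem_append, mem_restr] at hq
  rcases hq with ⟨-, rfl⟩ | ⟨-, rfl⟩ | ⟨-, rfl⟩ <;> simp only [Ivl.toSet_meet] at hα <;>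
    obtain ⟨-, h1, h2⟩ := hα <;> simp only [Cut.isLeftOf] at h1 h2
  · refine ⟨⟨h1, by linarith⟩, ?_⟩
    rw [if_neg (by linarith)]; simp only [Piece.quad]; ring
  · obtain rfl : α = 0 := by linarith
    refine ⟨⟨hl, hu⟩, ?_⟩
    rw [if_pos rfl]; simp only [Piece.quad]; ring
  · refine ⟨⟨by linarith, by linarith⟩, ?_⟩
    rw [if_neg (by linarith)]; simp only [Piece.quad]; ring

theorem split_side {lam2 z l u : ℝ} {p q : Piece ℝ}
    (hq : q ∈ split lam2 z l u p) :
    q.ivl.toSet ⊆ Set.Iio 0 ∨ q.ivl.toSet ⊆ {0} ∨ q.ivl.toSet ⊆ Set.Ioi 0 := by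
  simp only [split, List.mem_append, mem_restr] at hq
  rcases hq with ⟨-, rfl⟩ | ⟨-, rfl⟩ | ⟨-, rfl⟩
  · left
    rintro α hα
    simp only [Ivl.toSet_meet] at hα
    obtain ⟨-, h1, h2⟩ := hα
    simpa [Cut.isLeftOf] using h2
  · right; left
    rintro α hα
    simp only [Ivl.toSet_meet] at hα
    obtain ⟨-, h1, h2⟩ := hα
    simp only [Cut.isLeftOf] at h1 h2
    exact le_antisymm (not_lt.1 h2) h1
  · right; right
    rintro α hα
    simp only [Ivl.toSet_meet] at hα
    exact hα.2.1

theorem split_cover {lam2 z l u : ℝ} {p : Piece ℝ} {α : ℝ} (hα : α ∈ p.ivl.toSet)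
    (h : α ∈ Set.Icc l u) : ∃ q ∈ split lam2 z l u p, α ∈ q.ivl.toSet := by
  have key : ∀ J e, α ∈ J.toSet → ∃ q ∈ restr z e J p, α ∈ q.ivl.toSet := by
    intro J e hJ
    have : α ∈ (p.ivl.meet J).toSet := by rw [Ivl.toSet_meet]; exact ⟨hα, hJ⟩
    exact ⟨_, mem_restr.2 ⟨Ivl.nonempty_iff.1 ⟨α, this⟩, rfl⟩, this⟩
  simp only [split, List.mem_append]
  rcases lt_trichotomy α 0 with h0 | h0 | h0
  · obtain ⟨q, hq, hα⟩ := key ⟨.pt l false, .pt 0 false⟩ (1 / 2 * (z * z) + lam2) ⟨h.1, not_le.2 h0⟩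
    exact ⟨q, .inl hq, hα⟩
  · obtain ⟨q, hq, hα⟩ := key ⟨.pt 0 false, .pt 0 true⟩ (1 / 2 * (z * z)) ⟨h0.ge, h0.le.not_gt⟩
    exact ⟨q, .inr (.inl hq), hα⟩
  · obtain ⟨q, hq, hα⟩ := key ⟨.pt 0 true, .pt u true⟩ (1 / 2 * (z * z) + lam2) ⟨h0, not_lt.2 h.2⟩
    exact ⟨q, .inr (.inr hq), hα⟩

/-- Different pieces cut from one part never contain points of equal sign. Hence a separation
property required only for `0 < α γ` holds for them vacuously. -/
theorem split_pairwise (lam2 z l u : ℝ) (p : Piece ℝ) : (split lam2 z l u p).Pairwise fun q r =>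
    q.ivl.before r.ivl ∧ ∀ α ∈ q.ivl.toSet, ∀ γ ∈ r.ivl.toSet, ¬ 0 < α * γ := by
  have key : ∀ {J J' : Ivl ℝ} {e e' : ℝ}, J'.lo.up ⊆ J.hi.up →
      (∀ α ∈ J.toSet, ∀ γ ∈ J'.toSet, ¬ 0 < α * γ) →
      ∀ q ∈ restr z e J p, ∀ r ∈ restr z e' J' p,
      q.ivl.before r.ivl ∧ ∀ α ∈ q.ivl.toSet, ∀ γ ∈ r.ivl.toSet, ¬ 0 < α * γ := by
    intro J J' e e' h1 h2 q hq r hr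
    obtain ⟨-, rfl⟩ := mem_restr.1 hq
    obtain ⟨-, rfl⟩ := mem_restr.1 hr
    refine ⟨?_, ?_⟩
    · simp only [Ivl.before, Ivl.up_meet_lo, Ivl.up_meet_hi]
      exact (Set.inter_subset_right.trans h1).trans Set.subset_union_right
    · simp only [Ivl.toSet_meet]
      exact fun α hα γ hγ => h2 α hα.2 γ hγ.2
  refine List.pairwise_append.2 ⟨restr_pairwise _, List.pairwise_append.2
    ⟨restr_pairwise _, restr_pairwise _, ?_⟩, ?_⟩
  · refine key subset_rfl ?_
    rintro α ⟨-, h1⟩ γ ⟨h2, -⟩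
    simp only [Cut.isLeftOf] at h1 h2
    nlinarith
  · intro q hq r hr
    rcases List.mem_append.1 hr with hr | hr
    · refine key subset_rfl ?_ q hq r hr
      rintro α ⟨-, h1⟩ γ ⟨h2, -⟩
      simp only [Cut.isLeftOf] at h1 h2
      nlinarith
    · refine key ?_ ?_ q hq r hr
      · exact Set.Ioi_subset_Ici_self
      · rintro α ⟨-, h1⟩ γ ⟨h2, -⟩
        simp only [Cut.isLeftOf] at h1 h2
        nlinarith

/-! ### Intersections of lists of intervals -/

theorem mem_meets {old : List (Ivl ℝ)} {I M : Ivl ℝ} :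
    M ∈ meets old I ↔ M.lo.lt M.hi ∧ ∃ J ∈ old, M = I.meet J := by
  simp only [meets, List.mem_filter, List.mem_map, decide_eq_true_eq]
  constructor
  · rintro ⟨⟨J, hJ, rfl⟩, h⟩
    exact ⟨h, J, hJ, rfl⟩
  · rintro ⟨h, J, hJ, rfl⟩
    exact ⟨⟨J, hJ, rfl⟩, h⟩

theorem meets_toSet {old : List (Ivl ℝ)} {I M : Ivl ℝ} (h : M ∈ meets old I) :
    M.toSet ⊆ I.toSet ∧ ∃ J ∈ old, M.toSet ⊆ J.toSet := by
  obtain ⟨-, J, hJ, rfl⟩ := mem_meets.1 h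
  rw [Ivl.toSet_meet]
  exact ⟨Set.inter_subset_left, J, hJ, Set.inter_subset_right⟩

theorem unionSet_meets (old L : List (Ivl ℝ)) :
    unionSet (L.flatMap (meets old)) = unionSet L ∩ unionSet old := by
  ext α
  simp only [unionSet, Set.mem_ofPred_eq, List.mem_flatMap, Set.mem_inter_iff]
  constructor
  · rintro ⟨M, ⟨I, hI, hM⟩, hα⟩
    obtain ⟨h1, J, hJ, h2⟩ := meets_toSet hM
    exact ⟨⟨I, hI, h1 hα⟩, J, hJ, h2 hα⟩
  · rintro ⟨⟨I, hI, hαI⟩, J, hJ, hαJ⟩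
    have : α ∈ (I.meet J).toSet := by rw [Ivl.toSet_meet]; exact ⟨hαI, hαJ⟩
    exact ⟨_, ⟨I, hI, mem_meets.2 ⟨Ivl.nonempty_iff.1 ⟨α, this⟩, J, hJ, rfl⟩⟩, this⟩

theorem pairwise_disjoint_meets {old F : List (Ivl ℝ)}
    (ho : old.Pairwise fun I J => Disjoint I.toSet J.toSet)
    (hF : F.Pairwise fun I J => Disjoint I.toSet J.toSet) :
    (F.flatMap (meets old)).Pairwise fun I J => Disjoint I.toSet J.toSet := by
  refine List.pairwise_flatMap.2 ⟨fun I _ => ?_, hF.imp fun {I J} h M hM M' hM' => ?_⟩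
  · refine List.Pairwise.filter _ (List.pairwise_map.2 (ho.imp fun {J J'} h => ?_))
    simp only [Ivl.toSet_meet]
    exact h.mono Set.inter_subset_right Set.inter_subset_right
  · exact h.mono (meets_toSet hM).1 (meets_toSet hM').1

-- As the family is disjoint, `J` meets at most the one member that contains it.
open Classical in
theorem countP_meet_le_one {F : List (Ivl ℝ)} {J : Ivl ℝ}
    (hF : F.Pairwise fun I J => Disjoint I.toSet J.toSet) (hJ : ∃ I ∈ F, J.toSet ⊆ I.toSet) :
    F.countP (fun I => (I.meet J).lo.lt (I.meet J).hi) ≤ 1 := by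
  induction F with
  | nil => simp
  | cons I F ih =>
    obtain ⟨h1, h2⟩ := List.pairwise_cons.1 hF
    obtain ⟨I₀, hI₀, hsub⟩ := hJ
    rw [List.countP_cons]
    rcases List.mem_cons.1 hI₀ with rfl | hI₀
    · have : F.countP (fun I => (I.meet J).lo.lt (I.meet J).hi) = 0 := by
        rw [List.countP_eq_zero]
        intro I' hI' hlt
        simp only [decide_eq_true_eq, ← Ivl.nonempty_iff, Ivl.toSet_meet] at hlt
        obtain ⟨α, hα1, hα2⟩ := hlt
        exact Set.disjoint_left.1 (h1 I' hI') (hsub hα2) hα1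
      rw [this]
      split_ifs <;> simp
    · have : ¬ (I.meet J).lo.lt (I.meet J).hi := by
        rw [← Ivl.nonempty_iff, Ivl.toSet_meet]
        rintro ⟨α, hα1, hα2⟩
        exact Set.disjoint_left.1 (h1 I₀ hI₀) hα1 (hsub hα2)
      simpa [this] using ih h2 ⟨I₀, hI₀, hsub⟩

/-- Counting by members of `old` instead of by members of `F`: each contributes at most one nonempty
intersection. This keeps the interval lists linear in `s` instead of letting them multiply at each
stage. -/
theorem length_flatMap_meets_le {F old : List (Ivl ℝ)}
    (hF : F.Pairwise fun I J => Disjoint I.toSet J.toSet)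
    (hold : ∀ J ∈ old, ∃ I ∈ F, J.toSet ⊆ I.toSet) :
    (F.flatMap (meets old)).length ≤ old.length := by
  induction old with
  | nil => simp [meets]
  | cons J old ih =>
    classical
    have h1 := ih (fun J' hJ' => hold J' (by simp [hJ']))
    have h2 := countP_meet_le_one hF (hold J (by simp))
    have h3 : ∀ G : List (Ivl ℝ), (G.flatMap (meets (J :: old))).length =
        G.countP (fun I => (I.meet J).lo.lt (I.meet J).hi) + (G.flatMap (meets old)).length := by
      intro G
      induction G with
      | nil => simp
      | cons I G ihG =>
        simp only [List.flatMap_cons, List.length_append, ihG, List.countP_cons, meets,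
          List.map_cons, List.filter_cons, decide_eq_true_eq]
        split_ifs <;> simp <;> omega
    rw [h3, List.length_cons]
    omega

/-! ### The invariant of the forward loop -/

section Invariant

variable {n : ℕ} {lam1 lam2 : ℝ} {z l u : Fin n → ℝ}

/-- What is known about the data of the algorithm for one value of `s`. -/
structure Inv (lam1 lam2 : ℝ) (z l u : Fin n → ℝ) (s : ℕ) (st : Stage ℝ) : Prop where
  pos : ∀ p ∈ st.P, 0 < p.a ∧ p.ivl.lo.lt p.ivl.hi
  ord : st.P.Pairwise fun p q => p.ivl.before q.ivl
  value : ∀ p ∈ st.P, ∀ α ∈ p.ivl.toSet, Pstar lam1 lam2 z l u s α = (p.quad α : ℝ)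
  cover : ∀ α, Pstar lam1 lam2 z l u s α ≠ ⊤ → ∃ p ∈ st.P, α ∈ p.ivl.toSet
  side : ∀ p ∈ st.P, p.ivl.toSet ⊆ Set.Iio 0 ∨ p.ivl.toSet ⊆ {0} ∨ p.ivl.toSet ⊆ Set.Ioi 0
  sep : st.P.Pairwise fun p q => ∀ α ∈ p.ivl.toSet, ∀ γ ∈ q.ivl.toSet, 0 < α * γ →
    ∀ i, α ∈ Rset lam1 lam2 z l u s i → γ ∈ Rset lam1 lam2 z l u s i →
      ∃ β, α < β ∧ β < γ ∧ β ∉ Rset lam1 lam2 z l u s i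
  lengthR : st.R.length = s
  union : ∀ i < s, ∃ L, st.R[s - 1 - i]? = some L ∧ unionSet L = Rset lam1 lam2 z l u s i
  disj : st.R.flatten.Pairwise fun I J => Disjoint I.toSet J.toSet
  sub : ∀ p ∈ st.P, ∃ I ∈ st.R.flatten, p.ivl.toSet ⊆ I.toSet
  flat : st.R.flatten.length ≤ 16 * s + 5

theorem Inv.exists_Rset {s : ℕ} {st : Stage ℝ} (h : Inv lam1 lam2 z l u s st) :
    ∀ p ∈ st.P, ∃ i < s, p.ivl.toSet ⊆ Rset lam1 lam2 z l u s i := by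
  intro p hp
  obtain ⟨I, hI, hsub⟩ := h.sub p hp
  obtain ⟨L, hL, hIL⟩ := List.mem_flatten.1 hI
  obtain ⟨k, hk, rfl⟩ := List.getElem_of_mem hL
  have hks : k < s := h.lengthR ▸ hk
  -- The lists are stored newest first, so position `k` holds `R_s^{s-1-k}`.
  obtain ⟨L', h1, h2⟩ := h.union (s - 1 - k) (by omega)
  rw [show s - 1 - (s - 1 - k) = k by omega, List.getElem?_eq_getElem hk, Option.some.injEq] at h1
  refine ⟨s - 1 - k, by omega, fun α hα => ?_⟩
  rw [← h2, ← h1]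
  exact ⟨I, hIL, hsub hα⟩

/-- On one side of `0` all points are nonzero and of equal sign, so both the absence of interlacing
and the separation of `Inv` apply. As the domain is an interval, the points between two pieces of
this side are covered by pieces of the same side. -/
theorem Inv.length_side (h1 : 0 < lam1) (h2 : 0 < lam2) (hl : ∀ i, l i ≤ 0) (hu : ∀ i, 0 ≤ u i)
    {s : ℕ} (hs : 1 ≤ s) {st : Stage ℝ} (h : Inv lam1 lam2 z l u s st) (S : Set ℝ)
    (hS : S = Set.Iio 0 ∨ S = Set.Ioi 0) (L : List (Piece ℝ)) (hL : List.Sublist L st.P)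
    (hLS : ∀ p, p ∈ L ↔ p ∈ st.P ∧ p.ivl.toSet ⊆ S) : L.length ≤ 2 * s := by
  have hmem : ∀ p ∈ L, p ∈ st.P := fun p hp => ((hLS p).1 hp).1
  have hsub : ∀ p ∈ L, p.ivl.toSet ⊆ S := fun p hp => ((hLS p).1 hp).2
  have hS0 : ∀ α ∈ S, α ≠ 0 := by
    rintro α hα rfl
    rcases hS with rfl | rfl <;> simp at hα
  have hSmul : ∀ α ∈ S, ∀ γ ∈ S, 0 < α * γ := by
    intro α hα γ hγ
    rcases hS with rfl | rfl
    · exact mul_pos_of_neg_of_neg hα hγ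
    · exact mul_pos hα hγ
  have hSconv : S.OrdConnected := by
    rcases hS with rfl | rfl
    · exact Set.ordConnected_Iio
    · exact Set.ordConnected_Ioi
  refine length_le_of_sets (Rset lam1 lam2 z l u s) s L (fun p hp => (h.pos p (hmem p hp)).2)
    (h.ord.sublist hL) ?_ (fun p hp => h.exists_Rset p (hmem p hp)) ?_ ?_
  · refine List.Pairwise.imp_of_mem ?_ (h.sep.sublist hL)
    intro p q hp hq hpq α hα γ hγ
    exact hpq α hα γ hγ (hSmul α (hsub p hp hα) γ (hsub q hq hγ))
  · intro p hp q hq α hα γ hγ β hαβ hβγ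
    have hdom : ∀ r ∈ L, ∀ x ∈ r.ivl.toSet, x ∈ Set.Icc (entry l s) (entry u s) := by
      intro r hr x hx
      rw [← Pstar_ne_top_iff (lam1 := lam1) (z := z) h1 h2 hl hu hs, h.value r (hmem r hr) x hx]
      exact EReal.coe_ne_top _
    have hβ : β ∈ Set.Icc (entry l s) (entry u s) :=
      ⟨(hdom p hp α hα).1.trans hαβ.le, hβγ.le.trans (hdom q hq γ hγ).2⟩
    obtain ⟨r, hr, hβr⟩ := h.cover β ((Pstar_ne_top_iff h1 h2 hl hu hs β).2 hβ)
    have hβS : β ∈ S := hSconv.out (hsub p hp hα) (hsub q hq hγ) ⟨hαβ.le, hβγ.le⟩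
    refine ⟨r, (hLS r).2 ⟨hr, ?_⟩, hβr⟩
    rcases h.side r hr with h' | h' | h' <;> have hb := h' hβr
    · rcases hS with rfl | rfl
      · exact h'
      · simp only [Set.mem_Iio, Set.mem_Ioi] at hb hβS; linarith
    · exact absurd hb (hS0 β hβS)
    · rcases hS with rfl | rfl
      · simp only [Set.mem_Iio, Set.mem_Ioi] at hb hβS; linarith
      · exact h'
  · intro i j hij hj p hp q hq r hr α hα β hβ γ hγ hαβ hβγ mα mβ mγ
    exact Rset_not_interlaced h1 h2 hl hu hij hj (hS0 α (hsub p hp hα)) (hS0 β (hsub q hq hβ))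
      (hS0 γ (hsub r hr hγ)) hαβ hβγ mα mβ mγ

theorem length_le_one_of_common_mem {L : List (Piece ℝ)} {α : ℝ}
    (hord : L.Pairwise fun p q => p.ivl.before q.ivl) (hm : ∀ p ∈ L, α ∈ p.ivl.toSet) :
    L.length ≤ 1 := by
  rcases L with _ | ⟨p, _ | ⟨q, t⟩⟩
  · simp
  · simp
  · have := (List.pairwise_cons.1 hord).1 q (by simp)
    exact absurd (this.lt (hm p (by simp)) (hm q (by simp))) (lt_irrefl _)

/-- At most `2 s` pieces on each side of `0`, and one at `0`: ordered pieces are disjoint, and every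
nonempty piece inside `{0}` contains `0`. -/
theorem Inv.length_le (h1 : 0 < lam1) (h2 : 0 < lam2) (hl : ∀ i, l i ≤ 0) (hu : ∀ i, 0 ≤ u i)
    {s : ℕ} (hs : 1 ≤ s) {st : Stage ℝ} (h : Inv lam1 lam2 z l u s st) :
    st.P.length ≤ 4 * s + 1 := by
  classical
  have hneg := h.length_side h1 h2 hl hu hs (Set.Iio 0) (.inl rfl)
    (st.P.filter fun p => p.ivl.toSet ⊆ Set.Iio 0) List.filter_sublist (by simp)
  have hpos := h.length_side h1 h2 hl hu hs (Set.Ioi 0) (.inr rfl)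
    (st.P.filter fun p => p.ivl.toSet ⊆ Set.Ioi 0) List.filter_sublist (by simp)
  have hzero : (st.P.filter fun p => p.ivl.toSet ⊆ ({0} : Set ℝ)).length ≤ 1 := by
    have hord := h.ord.sublist (List.filter_sublist (p := fun p => p.ivl.toSet ⊆ ({0} : Set ℝ)))
    have hm : ∀ p ∈ st.P.filter (fun p => p.ivl.toSet ⊆ ({0} : Set ℝ)), (0 : ℝ) ∈ p.ivl.toSet := by
      intro p hp
      simp only [List.mem_filter, decide_eq_true_eq] at hp
      obtain ⟨α, hα⟩ := Ivl.nonempty_iff.2 (h.pos p hp.1).2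
      obtain rfl : α = 0 := hp.2 hα
      exact hα
    exact length_le_one_of_common_mem hord hm
  have key : ∀ L : List (Piece ℝ), (∀ p ∈ L, p.ivl.toSet ⊆ Set.Iio 0 ∨ p.ivl.toSet ⊆ {0} ∨
      p.ivl.toSet ⊆ Set.Ioi 0) → L.length ≤ (L.filter fun p => p.ivl.toSet ⊆ Set.Iio 0).length +
      (L.filter fun p => p.ivl.toSet ⊆ ({0} : Set ℝ)).length +
      (L.filter fun p => p.ivl.toSet ⊆ Set.Ioi 0).length := by
    intro L hL
    induction L with
    | nil => simp
    | cons p L ih =>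
      have := ih (fun q hq => hL q (by simp [hq]))
      have := hL p (by simp)
      simp only [List.filter_cons, decide_eq_true_eq, List.length_cons]
      split_ifs <;> (try simp only [List.length_cons]) <;> first | omega | tauto
  have := key st.P h.side
  omega

theorem Inv.minimize (h1 : 0 < lam1) (h2 : 0 < lam2) (hl : ∀ i, l i ≤ 0) (hu : ∀ i, 0 ≤ u i)
    {s : ℕ} {st : Stage ℝ} (h : Inv lam1 lam2 z l u s st) :
    ∃ m v, val (minimize st.P) = some (m, v) ∧ Pstar lam1 lam2 z l u s v = (m : ℝ) ∧
      ∀ α, (m : EReal) ≤ Pstar lam1 lam2 z l u s α := by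
  have hne : st.P ≠ [] := by
    intro h0
    obtain ⟨p, hp, -⟩ := h.cover 0 (Pstar_zero_ne_top hl hu s)
    simp [h0] at hp
  obtain ⟨m, v, e, ⟨p, hp, hm, hv⟩, hmin⟩ := minimize_spec hne h.pos
  have hle : ∀ α, (m : EReal) ≤ Pstar lam1 lam2 z l u s α := by
    intro α
    by_cases ht : Pstar lam1 lam2 z l u s α = ⊤
    · rw [ht]; exact le_top
    · obtain ⟨q, hq, hα⟩ := h.cover α ht
      rw [h.value q hq α hα]
      exact_mod_cast hmin q hq α hα
  refine ⟨m, v, e, le_antisymm ?_ (hle v), hle⟩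
  rw [hm]
  exact le_quad_of_mem_closure (lowerSemicontinuous_Pstar h1 h2 hl hu s) (h.value p hp) hv

theorem pieceFun_eq {P : List (Piece ℝ)} {f : ℝ → EReal}
    (hv : ∀ p ∈ P, ∀ α ∈ p.ivl.toSet, f α = (p.quad α : ℝ))
    (hc : ∀ α, f α ≠ ⊤ → ∃ p ∈ P, α ∈ p.ivl.toSet) : pieceFun P = f := by
  ext α
  by_cases hα : ∃ p ∈ P, α ∈ p.ivl.toSet
  · clear hc
    induction P with
    | nil => simp at hα
    | cons p P ih =>
      rw [pieceFun]
      split_ifs with hp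
      · rw [hv p (by simp) α hp]; rfl
      · refine ih (fun q hq => hv q (by simp [hq])) ?_
        obtain ⟨q, hq, hα⟩ := hα
        rcases List.mem_cons.1 hq with rfl | hq
        · exact absurd hα hp
        · exact ⟨q, hq, hα⟩
  · have : f α = ⊤ := by
      by_contra hn
      exact hα (hc α hn)
    rw [this]
    push Not at hα
    clear hv hc this
    induction P with
    | nil => rfl
    | cons p P ih =>
      rw [pieceFun, if_neg (hα p (by simp))]
      exact ih (fun q hq => hα q (by simp [hq]))

theorem Inv.isPLQ {s : ℕ} {st : Stage ℝ} (h : Inv lam1 lam2 z l u s st) :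
    IsPLQ (Pstar lam1 lam2 z l u s) st.P.length := by
  refine ⟨fun j => (st.P.get j).ivl.toSet, fun j => (st.P.get j).a, fun j => (st.P.get j).b,
    fun j => (st.P.get j).d, fun j => Ivl.ordConnected _, ?_, ?_, ?_⟩
  · have key : ∀ i j : Fin st.P.length, i < j →
        Disjoint (st.P.get i).ivl.toSet (st.P.get j).ivl.toSet := by
      intro i j hij
      have := List.pairwise_iff_get.1 h.ord i j hij
      exact Set.disjoint_left.2 fun α hα hα' => lt_irrefl _ (this.lt hα hα')
    intro i j hij
    rcases lt_or_gt_of_ne hij with hlt | hlt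
    · exact key i j hlt
    · exact (key j i hlt).symm
  · ext α
    simp only [Set.mem_iUnion, Set.mem_ofPred_eq]
    constructor
    · rintro ⟨j, hj⟩
      rw [h.value _ (List.get_mem _ _) α hj]
      exact EReal.coe_ne_top _
    · intro hα
      obtain ⟨p, hp, hα⟩ := h.cover α hα
      obtain ⟨j, rfl⟩ := List.get_of_mem hp
      exact ⟨j, hα⟩
  · intro j α hα
    exact h.value _ (List.get_mem _ _) α hα

end Invariant


/-! ### The forward step preserves the invariant -/

section Step

variable {n : ℕ} {lam1 lam2 : ℝ} {z l u : Fin n → ℝ}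

/-- The added `α² / 2` makes even the constant parts strictly convex, which `minPiece` and
`sublevel` rely on at the next stage. -/
theorem pos_addTerm {lam2 z l u : ℝ} {L : List (Bool × Piece ℝ)} (ha : ∀ x ∈ L, 0 ≤ x.2.a) :
    ∀ p ∈ val (addTerm lam2 z l u L), 0 < p.a ∧ p.ivl.lo.lt p.ivl.hi := by
  intro p hp
  rw [val_addTerm] at hp
  obtain ⟨x, hx, hp⟩ := List.mem_flatMap.1 hp
  obtain ⟨h1, h2, -⟩ := split_before hp
  exact ⟨by rw [h2]; linarith [ha x hx], h1⟩

theorem ord_addTerm {lam2 z l u : ℝ} {c : Cut ℝ} {L : List (Bool × Piece ℝ)} (hL : Tiles c L) :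
    (val (addTerm lam2 z l u L)).Pairwise fun p q => p.ivl.before q.ivl := by
  rw [val_addTerm, List.pairwise_flatMap]
  refine ⟨fun x _ => (split_pairwise lam2 z l u x.2).imp And.left, hL.pairwise.imp ?_⟩
  intro x y hxy p hp q hq
  obtain ⟨-, -, -, h1⟩ := split_before hp
  obtain ⟨-, -, h2, -⟩ := split_before hq
  exact (h2.trans hxy).trans h1

theorem sep_addTerm {lam2 z l u : ℝ} {L : List (Bool × Piece ℝ)} {K : ℝ → ℝ → Prop}
    (hK : L.Pairwise fun x y => ∀ α ∈ x.2.ivl.toSet, ∀ γ ∈ y.2.ivl.toSet, 0 < α * γ → K α γ) :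
    (val (addTerm lam2 z l u L)).Pairwise fun p q =>
      ∀ α ∈ p.ivl.toSet, ∀ γ ∈ q.ivl.toSet, 0 < α * γ → K α γ := by
  rw [val_addTerm, List.pairwise_flatMap]
  refine ⟨fun x _ => (split_pairwise lam2 z l u x.2).imp ?_, hK.imp ?_⟩
  · intro p q hpq α hα γ hγ h
    exact absurd h (hpq.2 α hα γ hγ)
  · intro x y hxy p hp q hq α hα γ hγ h
    exact hxy α (split_toSet hp hα) γ (split_toSet hq hγ) h

theorem value_addTerm {s : ℕ} (hl : ∀ i, l i ≤ 0) (hu : ∀ i, 0 ≤ u i) {L : List (Bool × Piece ℝ)}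
    (hv : ∀ x ∈ L, ∀ α ∈ x.2.ivl.toSet, α ∈ Set.Icc (entry l s) (entry u s) →
      Pstar lam1 lam2 z l u s α = ((x.2.quad α + termR lam2 z s α : ℝ) : EReal)) :
    ∀ p ∈ val (addTerm lam2 (entry z s) (entry l s) (entry u s) L), ∀ α ∈ p.ivl.toSet,
      Pstar lam1 lam2 z l u s α = (p.quad α : ℝ) := by
  intro p hp α hα
  rw [val_addTerm] at hp
  obtain ⟨x, hx, hp⟩ := List.mem_flatMap.1 hp
  obtain ⟨h1, h2⟩ := split_quad (entry_nonpos hl s) (entry_nonneg hu s) hp α hα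
  rw [hv x hx α (split_toSet hp hα) h1, h2, termR]

theorem cover_addTerm {lam2 z l u : ℝ} {L : List (Bool × Piece ℝ)} (hL : Tiles .negInf L) {α : ℝ}
    (hα : α ∈ Set.Icc l u) : ∃ p ∈ val (addTerm lam2 z l u L), α ∈ p.ivl.toSet := by
  rw [val_addTerm]
  obtain ⟨x, hx, hαx⟩ := hL.cover (Set.mem_univ α)
  obtain ⟨p, hp, hαp⟩ := split_cover (lam2 := lam2) (z := z) hαx hα
  exact ⟨p, List.mem_flatMap.2 ⟨x, hx, hp⟩, hαp⟩

theorem side_addTerm {lam2 z l u : ℝ} {L : List (Bool × Piece ℝ)} :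
    ∀ p ∈ val (addTerm lam2 z l u L),
      p.ivl.toSet ⊆ Set.Iio 0 ∨ p.ivl.toSet ⊆ {0} ∨ p.ivl.toSet ⊆ Set.Ioi 0 := by
  intro p hp
  rw [val_addTerm] at hp
  obtain ⟨x, hx, hp⟩ := List.mem_flatMap.1 hp
  exact split_side hp

theorem inv_initStage (h1 : 0 < lam1) (h2 : 0 < lam2) (hl : ∀ i, l i ≤ 0) (hu : ∀ i, 0 ≤ u i) :
    Inv lam1 lam2 z l u 1 (val (initStage lam2 (entry z 1) (entry l 1) (entry u 1))) := by
  set L : List (Bool × Piece ℝ) := [(true, ⟨⟨.negInf, .posInf⟩, 0, 0, 0⟩)] with hLdef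
  have hst : val (initStage lam2 (entry z 1) (entry l 1) (entry u 1)) =
      ⟨val (addTerm lam2 (entry z 1) (entry l 1) (entry u 1) L), [[⟨.negInf, .posInf⟩]]⟩ := by
    simp [initStage, hLdef]
  rw [hst]
  have huniv : (⟨.negInf, .posInf⟩ : Ivl ℝ).toSet = Set.univ := by
    ext α; simp [Ivl.mem_toSet]
  have hL : Tiles .negInf L := ⟨rfl, ⟨0, trivial, fun h => h⟩, rfl⟩
  refine
    { pos := pos_addTerm (by simp [hLdef])
      ord := ord_addTerm hL
      value := value_addTerm hl hu ?_
      cover := fun α hα => cover_addTerm hL ((Pstar_ne_top_iff h1 h2 hl hu le_rfl α).1 hα)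
      side := side_addTerm
      sep := sep_addTerm (List.pairwise_singleton _ _)
      lengthR := rfl
      union := ?_
      disj := List.pairwise_singleton _ _
      sub := fun p _ => ⟨⟨.negInf, .posInf⟩, by simp, by rw [huniv]; exact Set.subset_univ _⟩
      flat := by simp }
  · intro x hx α _ hα
    obtain rfl := List.mem_singleton.1 hx
    rw [Pstar_one, term_of_mem hα]
    simp [Piece.quad]
  · intro i hi
    obtain rfl : i = 0 := by omega
    refine ⟨_, rfl, ?_⟩
    ext α
    simp [unionSet, huniv, Rset]

theorem length_filter_add_length_filter {A : Type} (L : List (Bool × A)) :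
    (L.filter (fun x => x.1 = true)).length + (L.filter (fun x => x.1 = false)).length =
      L.length := by
  induction L with
  | nil => rfl
  | cons x L ih => rcases x with ⟨_ | _, p⟩ <;> simp at ih ⊢ <;> omega

/-- The parts marked `true` tile `R_{s+1}^s` and the others its complement. The earlier separation
property plays the role of `K` in `truncate_spec`. Each old part lies in one piece, and so in one
interval of the earlier family; this yields both `sub` and `flat`. -/
theorem Inv.next (h1 : 0 < lam1) (h2 : 0 < lam2) (hl : ∀ i, l i ≤ 0) (hu : ∀ i, 0 ≤ u i)
    {s : ℕ} (hs : 1 ≤ s) {st : Stage ℝ} (h : Inv lam1 lam2 z l u s st) :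
    Inv lam1 lam2 z l u (s + 1)
      (val (nextStage lam1 lam2 (entry z (s + 1)) (entry l (s + 1)) (entry u (s + 1)) st)) := by
  obtain ⟨m, v, hmin, hPv, hPle⟩ := h.minimize h1 h2 hl hu
  set c := m + lam1 with hc
  -- The computed minimum is attained, so the constant used by the program is the exact threshold.
  have hlev : level lam1 lam2 z l u s = (c : ℝ) := by
    rw [level, le_antisymm (hPv ▸ iInf_le _ v) (le_iInf hPle)]
    exact (EReal.coe_add _ _).symm
  set N := newSet lam1 lam2 z l u (s + 1) with hN
  have memN : ∀ α, α ∈ N ↔ ((c : ℝ) : EReal) ≤ Pstar lam1 lam2 z l u s α := by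
    intro α; rw [hN, mem_newSet, hlev]
  set L := val (truncate c .negInf st.P) with hLdef
  have hparts : Parts c N (fun α γ => 0 < α * γ → ∀ i, α ∈ Rset lam1 lam2 z l u s i →
      γ ∈ Rset lam1 lam2 z l u s i → ∃ β, α < β ∧ β < γ ∧ β ∉ Rset lam1 lam2 z l u s i)
      st.P .negInf L := by
    refine truncate_spec (sortedFrom_of_pairwise h.ord (fun p _ => Set.subset_univ _)
      (fun p hp => (h.pos p hp).2)) (fun p hp => (h.pos p hp).1) ?_ ?_ h.sep
    · intro p hp α hα
      rw [memN, h.value p hp α hα, EReal.coe_le_coe_iff]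
    · intro α _ hα
      rw [memN]
      have : Pstar lam1 lam2 z l u s α = ⊤ := by
        by_contra hn
        obtain ⟨p, hp, hαp⟩ := h.cover α hn
        exact hα p hp hαp
      rw [this]; exact le_top
  set new := (L.filter (fun x => x.1 = true)).map (fun x => x.2.ivl) with hnew
  set old := (L.filter (fun x => x.1 = false)).map (fun x => x.2.ivl) with hold
  have hst : val (nextStage lam1 lam2 (entry z (s + 1)) (entry l (s + 1)) (entry u (s + 1)) st) =
      ⟨val (addTerm lam2 (entry z (s + 1)) (entry l (s + 1)) (entry u (s + 1)) L),
        new :: st.R.map (fun L => L.flatMap (meets old))⟩ := by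
    simp [nextStage, hmin, val_marked, val_meetAll, hnew, hold, hLdef, hc]
  rw [hst]
  have mem_new : ∀ I, I ∈ new ↔ ∃ p, (true, p) ∈ L ∧ p.ivl = I := by
    intro I; simp [hnew]
  have mem_old : ∀ I, I ∈ old ↔ ∃ p, (false, p) ∈ L ∧ p.ivl = I := by
    intro I; simp [hold]
  have new_sub : ∀ I ∈ new, I.toSet ⊆ N := by
    intro I hI
    obtain ⟨p, hp, rfl⟩ := (mem_new I).1 hI
    exact (hparts.new _ hp rfl).1
  have old_sub : ∀ I ∈ old, I.toSet ⊆ Nᶜ := by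
    intro I hI
    obtain ⟨p, hp, rfl⟩ := (mem_old I).1 hI
    exact (hparts.old _ hp rfl).1
  have mem_some : ∀ α, ∃ I, α ∈ I.toSet ∧ (I ∈ new ∨ I ∈ old) := by
    intro α
    obtain ⟨⟨b, p⟩, hp, hα⟩ := hparts.tiles.cover (Set.mem_univ α)
    cases b with
    | true => exact ⟨p.ivl, hα, .inl ((mem_new _).2 ⟨p, hp, rfl⟩)⟩
    | false => exact ⟨p.ivl, hα, .inr ((mem_old _).2 ⟨p, hp, rfl⟩)⟩
  have union_new : unionSet new = N := by
    ext α
    refine ⟨fun ⟨I, hI, hα⟩ => new_sub I hI hα, fun hα => ?_⟩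
    obtain ⟨I, hαI, hI | hI⟩ := mem_some α
    · exact ⟨I, hI, hαI⟩
    · exact absurd hα (old_sub I hI hαI)
  have union_old : unionSet old = Nᶜ := by
    ext α
    refine ⟨fun ⟨I, hI, hα⟩ => old_sub I hI hα, fun hα => ?_⟩
    obtain ⟨I, hαI, hI | hI⟩ := mem_some α
    · exact absurd (new_sub I hI hαI) hα
    · exact ⟨I, hI, hαI⟩
  have hdisjL : ∀ M : List (Bool × Piece ℝ), List.Sublist M L →
      (M.map (fun x => x.2.ivl)).Pairwise fun I J => Disjoint I.toSet J.toSet := by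
    intro M hM
    refine List.pairwise_map.2 ((hparts.tiles.pairwise.sublist hM).imp ?_)
    intro x y hxy
    exact Set.disjoint_left.2 fun α hα hα' => lt_irrefl _ (hxy.lt hα hα')
  have old_part : ∀ J ∈ old, ∃ I ∈ st.R.flatten, J.toSet ⊆ I.toSet := by
    intro J hJ
    obtain ⟨p, hp, rfl⟩ := (mem_old J).1 hJ
    obtain ⟨-, q, hq, hsub, -⟩ := hparts.old _ hp rfl
    obtain ⟨I, hI, hqI⟩ := h.sub q hq
    exact ⟨I, hI, hsub.trans hqI⟩
  have hflat : (new :: st.R.map (fun L => L.flatMap (meets old))).flatten =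
      new ++ st.R.flatten.flatMap (meets old) := by
    rw [List.flatten_cons]
    congr 1
    induction st.R with
    | nil => rfl
    | cons A B ih => simp [ih]
  refine
    { pos := pos_addTerm ?_
      ord := ord_addTerm hparts.tiles
      value := value_addTerm hl hu ?_
      cover := fun α hα => cover_addTerm hparts.tiles
        ((Pstar_ne_top_iff h1 h2 hl hu (by omega) α).1 hα)
      side := side_addTerm
      sep := sep_addTerm (hparts.sep.imp ?_)
      lengthR := by simp [h.lengthR]
      union := ?_
      disj := ?_
      sub := ?_
      flat := ?_ }
  · rintro ⟨b, x⟩ hx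
    cases b with
    | true => exact (hparts.new _ hx rfl).2.1.ge
    | false =>
      obtain ⟨-, q, hq, -, hqa, -⟩ := hparts.old _ hx rfl
      exact hqa ▸ (h.pos q hq).1.le
  · rintro ⟨b, x⟩ hx α hαx hα
    rw [Pstar_succ hs, term_of_mem hα, EReal.coe_add, hlev]
    congr 1
    cases b with
    | true =>
      obtain ⟨hxN, ha, hb, hd⟩ := hparts.new _ hx rfl
      simp only at ha hb hd hαx
      rw [min_eq_right ((memN α).1 (hxN hαx)), Piece.quad, ha, hb, hd]
      simp
    | false =>
      obtain ⟨hxN, q, hq, hsub, ha, hb, hd⟩ := hparts.old _ hx rfl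
      simp only at ha hb hd hαx
      have hlt := hxN hαx
      rw [Set.mem_compl_iff, memN, not_le] at hlt
      rw [min_eq_left hlt.le, h.value q hq α (hsub hαx), Piece.quad, Piece.quad, ha, hb, hd]
  · intro x y hxy α hα γ hγ hpos i hαi hγi
    obtain ⟨k1, k2⟩ := hxy α hα γ hγ
    -- For the newest label the separator comes from the joining in `pushNew`. For an older one it
    -- comes from stage `s`, because the sets only shrink.
    by_cases his : i = s
    · rw [his, Rset_self hs] at hαi hγi ⊢
      exact k1 hαi hγi
    · rw [Rset_of_ne hs his] at hαi hγi ⊢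
      obtain ⟨β, b1, b2, b3⟩ := k2 hαi.2 hγi.2 hpos i hαi.1 hγi.1
      exact ⟨β, b1, b2, fun hh => b3 hh.1⟩
  · intro i hi
    by_cases his : i = s
    · refine ⟨new, by simp [his], ?_⟩
      rw [his, Rset_self hs, union_new]
    · obtain ⟨M, hM, hMu⟩ := h.union i (by omega)
      refine ⟨M.flatMap (meets old), ?_, ?_⟩
      · dsimp only
        rw [show s + 1 - 1 - i = (s - 1 - i) + 1 by omega, List.getElem?_cons_succ,
          List.getElem?_map, hM]
        rfl
      · rw [unionSet_meets, hMu, union_old, Rset_of_ne hs his]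
  · dsimp only
    rw [hflat]
    refine List.pairwise_append.2 ⟨hdisjL _ List.filter_sublist,
      pairwise_disjoint_meets (hdisjL _ List.filter_sublist) h.disj, ?_⟩
    intro I hI M hM
    obtain ⟨I', -, hM⟩ := List.mem_flatMap.1 hM
    obtain ⟨-, J, hJ, hMJ⟩ := meets_toSet hM
    exact Set.disjoint_left.2 fun α hα hα' => old_sub J hJ (hMJ hα') (new_sub I hI hα)
  · intro p hp
    dsimp only at hp ⊢
    rw [hflat]
    have hlt := (pos_addTerm (L := L) (by
      rintro ⟨b, x⟩ hx
      cases b with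
      | true => exact (hparts.new _ hx rfl).2.1.ge
      | false =>
        obtain ⟨-, q, hq, -, hqa, -⟩ := hparts.old _ hx rfl
        exact hqa ▸ (h.pos q hq).1.le) p hp).2
    rw [val_addTerm] at hp
    obtain ⟨⟨b, x⟩, hx, hp⟩ := List.mem_flatMap.1 hp
    have hpx := split_toSet hp
    cases b with
    | true => exact ⟨x.ivl, List.mem_append_left _ ((mem_new _).2 ⟨x, hx, rfl⟩), hpx⟩
    | false =>
      have hxo := (mem_old x.ivl).2 ⟨x, hx, rfl⟩
      obtain ⟨I, hI, hxI⟩ := old_part _ hxo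
      have hpM : p.ivl.toSet ⊆ (I.meet x.ivl).toSet := by
        rw [Ivl.toSet_meet]
        exact Set.subset_inter (hpx.trans hxI) hpx
      refine ⟨I.meet x.ivl, List.mem_append_right _ (List.mem_flatMap.2 ⟨I, hI, ?_⟩), hpM⟩
      -- The intersection is not discarded, as it contains the nonempty piece `p`.
      exact mem_meets.2 ⟨Ivl.nonempty_iff.1 ((Ivl.nonempty_iff.2 hlt).mono hpM), x.ivl, hxo, rfl⟩
  · dsimp only
    rw [hflat, List.length_append]
    have k1 := length_flatMap_meets_le h.disj old_part
    have k2 : new.length + old.length = L.length := by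
      simp only [hnew, hold, List.length_map]
      exact length_filter_add_length_filter L
    -- New intervals and surviving intersections together number at most `4 (4 s + 1) + 1 = 16 s +
    -- 5`.
    have k3 : L.length ≤ 4 * st.P.length + 1 := length_truncate _ _ _
    have k4 := h.length_le h1 h2 hl hu hs
    omega

/-- Only `meetAll` is quadratic: it pairs all intervals of the family with all old parts, two lists
of length at most `16 s + 5`. Everything else is linear in `s`. -/
theorem Inv.cost_nextStage (h1 : 0 < lam1) (h2 : 0 < lam2) (hl : ∀ i, l i ≤ 0) (hu : ∀ i, 0 ≤ u i)
    {s : ℕ} (hs : 1 ≤ s) {st : Stage ℝ} (h : Inv lam1 lam2 z l u s st) (zs ls us : ℝ) :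
    cost (nextStage lam1 lam2 zs ls us st) ≤ 5000 * (s + 1) ^ 2 := by
  obtain ⟨m, v, hmin, -⟩ := h.minimize h1 h2 hl hu
  simp only [nextStage, cost_bind, hmin, cost_step, cost_addC, val_addC, cost_pure]
  set L := val (truncate (m + lam1) .negInf st.P)
  have k0 := cost_minimize st.P
  have k1 := cost_truncate (m + lam1) .negInf st.P
  have k2 := cost_addTerm lam2 zs ls us L
  have k3 := cost_marked true L
  have k4 := cost_marked false L
  have k5 := cost_meetAll (val (marked false L)) st.R
  have k6 : L.length ≤ 4 * st.P.length + 1 := length_truncate _ _ _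
  have k7 := h.length_le h1 h2 hl hu hs
  have k8 := h.flat
  have k9 : (val (marked false L)).length ≤ L.length := by
    rw [val_marked, List.length_map]; exact List.length_filter_le _ _
  rw [h.lengthR] at k5
  have k10 : st.R.flatten.length * (13 * (val (marked false L)).length + 2) ≤
      (16 * s + 5) * (13 * (16 * s + 5) + 2) := by
    refine Nat.mul_le_mul k8 ?_
    omega
  nlinarith

theorem cost_initStage (lam2 z l u : ℝ) : cost (initStage lam2 z l u) ≤ 60 := by
  have := cost_addTerm lam2 z l u [(true, ⟨⟨.negInf, .posInf⟩, 0, 0, 0⟩)]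
  simp [initStage] at this ⊢
  omega

end Step

section Loops

variable {n : ℕ} {lam1 lam2 : ℝ} {z l u : Fin n → ℝ}

/-! ### The forward loop -/

/-- The list holds correct stages for `s, s - 1, …, 1`. -/
def GoodStages (lam1 lam2 : ℝ) (z l u : Fin n → ℝ) : ℕ → List (Stage ℝ) → Prop
  | 0, L => L = []
  | _ + 1, [] => False
  | s + 1, st :: L => Inv lam1 lam2 z l u (s + 1) st ∧ GoodStages lam1 lam2 z l u s L

theorem GoodStages.exists_inv {t : ℕ} {L : List (Stage ℝ)} (h : GoodStages lam1 lam2 z l u t L)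
    {s : ℕ} (hs : 1 ≤ s) (hst : s ≤ t) : ∃ st, L[t - s]? = some st ∧ Inv lam1 lam2 z l u s st := by
  induction t generalizing L with
  | zero => omega
  | succ t ih =>
    cases L with
    | nil => exact h.elim
    | cons st L =>
      obtain ⟨h1, h2⟩ := h
      rcases Nat.lt_or_ge t s with hlt | hle
      · obtain rfl : s = t + 1 := by omega
        exact ⟨st, by simp, h1⟩
      · obtain ⟨st', e, h'⟩ := ih h2 hle
        exact ⟨st', by rw [show t + 1 - s = (t - s) + 1 by omega]; simpa using e, h'⟩

/-- The list holds the data `(z_k, l_k, u_k)` for `k = s + 1, s + 2, …`. -/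
def IsData (z l u : Fin n → ℝ) (s : ℕ) (ds : List (ℝ × ℝ × ℝ)) : Prop :=
  ∀ k (hk : k < ds.length), ds[k] = (entry z (s + k + 1), entry l (s + k + 1), entry u (s + k + 1))

theorem IsData.cons {s : ℕ} {d : ℝ × ℝ × ℝ} {ds : List (ℝ × ℝ × ℝ)} (h : IsData z l u s (d :: ds)) :
    d = (entry z (s + 1), entry l (s + 1), entry u (s + 1)) ∧ IsData z l u (s + 1) ds := by
  refine ⟨h 0 (by simp), fun k hk => ?_⟩
  have := h (k + 1) (by simpa using hk)
  rw [show s + 1 + k + 1 = s + (k + 1) + 1 by ring]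
  simpa using this

theorem isData_ofFn : IsData z l u 0 (List.ofFn fun i => (z i, l i, u i)) := by
  intro k hk
  simp only [List.length_ofFn] at hk
  simp [entry, hk]

theorem forward_spec (h1 : 0 < lam1) (h2 : 0 < lam2) (hl : ∀ i, l i ≤ 0) (hu : ∀ i, 0 ≤ u i)
    {N s : ℕ} {st : Stage ℝ} {done : List (Stage ℝ)} {ds : List (ℝ × ℝ × ℝ)}
    (hst : GoodStages lam1 lam2 z l u (s + 1) (st :: done)) (hd : IsData z l u (s + 1) ds)
    (hN : s + 1 + ds.length ≤ N) :
    GoodStages lam1 lam2 z l u (s + 1 + ds.length) (val (forward lam1 lam2 st done ds)) ∧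
      cost (forward lam1 lam2 st done ds) ≤ ds.length * (5000 * (N + 1) ^ 2 + 1) + 1 := by
  induction ds generalizing s st done with
  | nil => exact ⟨by simpa [forward] using hst, by simp [forward]⟩
  | cons d ds ih =>
    obtain ⟨rfl, hd'⟩ := hd.cons
    simp only [List.length_cons] at hN
    have hnext := hst.1.next h1 h2 hl hu (by omega)
    have hcost := hst.1.cost_nextStage h1 h2 hl hu (by omega) (entry z (s + 1 + 1))
      (entry l (s + 1 + 1)) (entry u (s + 1 + 1))
    have hmono : 5000 * (s + 1 + 1) ^ 2 ≤ 5000 * (N + 1) ^ 2 := by gcongr; omega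
    obtain ⟨i1, i2⟩ := ih (s := s + 1) (done := st :: done) ⟨hnext, hst⟩ hd' (by omega)
    refine ⟨?_, ?_⟩
    · simp only [forward, val_bind, List.length_cons]
      rw [show s + 1 + (ds.length + 1) = s + 1 + 1 + ds.length by ring]
      exact i1
    · simp only [forward, cost_bind, cost_step, List.length_cons, add_mul, one_mul]
      linarith

/-! ### The objective function -/

/-- The part of the objective that involves the entries `x_1, …, x_s` only. -/
noncomputable def energy (lam1 lam2 : ℝ) (z l u : Fin n → ℝ) : ℕ → (ℕ → ℝ) → EReal
  | 0, _ => 0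
  | s + 1, x => energy lam1 lam2 z l u s x +
      ((if s = 0 ∨ x s = x (s + 1) then 0 else lam1 : ℝ) : EReal) + term lam2 z l u (s + 1) (x (s + 1))

/-- A competitor that keeps its value corresponds to the first alternative of the minimum. One that
jumps pays `λ₁` on top of at least the infimum, which is the threshold. -/
theorem Pstar_le_energy {s : ℕ} (hs : 1 ≤ s) (x : ℕ → ℝ) :
    Pstar lam1 lam2 z l u s (x s) ≤ energy lam1 lam2 z l u s x := by
  induction s, hs using Nat.le_induction with
  | base => simp [Pstar_one, energy]
  | succ s hs ih =>
    rw [Pstar_succ hs, energy]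
    refine add_le_add_left ?_ _
    split_ifs with h
    · have hx : x s = x (s + 1) := h.resolve_left (by omega)
      rw [EReal.coe_zero, add_zero, ← hx]
      exact (min_le_left _ _).trans ih
    · exact (min_le_right _ _).trans (add_le_add_left ((iInf_le _ (x s)).trans ih) _)

/-- A list as a sequence of entries numbered from `1`. -/
def entries (r : List ℝ) (k : ℕ) : ℝ := r.getD (k - 1) 0

theorem entries_of_drop {r x : List ℝ} {s : ℕ} {α : ℝ} (h : r.drop s = α :: x) :
    entries r (s + 1) = α := by
  have : r[s]? = some α := by
    have := congrArg (fun L => L[0]?) h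
    simpa using this
  simp [entries, this]

/-- Here `k` is the number of further entries of the block of `α`, so `s - k` is the label. For `k =
0` the label says that the threshold is attained in the minimum, and the entries up to `s` are
optimal on their own. For `1 ≤ k` it says that `P_s^*(α)` is below the threshold, and the value is
carried on. -/
theorem energy_step_le (h1 : 0 < lam1) {s k : ℕ} {r x : List ℝ} {α : ℝ}
    (hr : r.drop s = α :: x) (hk : k ≤ s) (hα : α ∈ Rset lam1 lam2 z l u (s + 1) (s - k))
    (hnew : k = 0 → 1 ≤ s → ∀ β, energy lam1 lam2 z l u s (entries r) ≤ Pstar lam1 lam2 z l u s β)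
    (hcont : 1 ≤ k → α ∈ Rset lam1 lam2 z l u s (s - k) → entries r s = α ∧
      energy lam1 lam2 z l u s (entries r) ≤ Pstar lam1 lam2 z l u s α) :
    energy lam1 lam2 z l u (s + 1) (entries r) ≤ Pstar lam1 lam2 z l u (s + 1) α := by
  have hx := entries_of_drop hr
  rcases Nat.eq_zero_or_pos s with rfl | hs
  · simp [energy, Pstar_one, hx]
  · rw [Pstar_succ hs, energy, hx]
    refine add_le_add_left ?_ _
    rcases Nat.eq_zero_or_pos k with rfl | hk0
    · rw [Nat.sub_zero, Rset_self hs] at hα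
      rw [min_eq_right (mem_newSet.1 hα)]
      -- Only an inequality: a new block may happen to repeat the value, and then the jump is free.
      refine add_le_add (le_iInf (hnew rfl hs)) (EReal.coe_le_coe_iff.2 ?_)
      split_ifs
      · exact h1.le
      · exact le_rfl
    · rw [Rset_of_ne hs (by omega)] at hα
      obtain ⟨e1, e2⟩ := hcont hk0 hα.1
      rw [min_eq_left (not_le.1 (fun hh => hα.2 (mem_newSet.2 hh))).le, e1]
      simpa using e2

/-! ### The backward loop -/

/-- The induction needs two claims at once: optimality against every `β` where a block begins, and
optimality for the prescribed last entry `α` inside a block. They are the hypotheses `hnew` and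
`hcont` of `energy_step_le`. -/
theorem backward_spec (h1 : 0 < lam1) (h2 : 0 < lam2) (hl : ∀ i, l i ≤ 0) (hu : ∀ i, 0 ≤ u i)
    {s : ℕ} {L : List (Stage ℝ)} (hL : GoodStages lam1 lam2 z l u s L) (k : ℕ) (o : Option ℝ)
    (x : List ℝ) :
    let r := val (backward L k o x)
    r.length = s + x.length ∧ r.drop s = x ∧
    (k = 0 → 1 ≤ s → ∀ β, energy lam1 lam2 z l u s (entries r) ≤ Pstar lam1 lam2 z l u s β) ∧
    ∀ α, o = some α → 1 ≤ k → k ≤ s → α ∈ Rset lam1 lam2 z l u s (s - k) →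
      entries r s = α ∧ energy lam1 lam2 z l u s (entries r) ≤ Pstar lam1 lam2 z l u s α := by
  induction s generalizing L k o x with
  | zero =>
    obtain rfl : L = [] := hL
    refine ⟨by simp [backward], by simp [backward], ?_, ?_⟩
    · intro _ h; omega
    · intro α _ h h'; omega
  | succ s ih =>
    cases L with
    | nil => exact hL.elim
    | cons st L =>
      obtain ⟨hst, hL⟩ := hL
      have fresh : ∀ m v, val (minimize st.P) = some (m, v) →
          (∀ β, (m : EReal) ≤ Pstar lam1 lam2 z l u (s + 1) β) →
          Pstar lam1 lam2 z l u (s + 1) v = (m : ℝ) →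
          let r := val (backward L (val (findSet v st.R)) (some v) (v :: x))
          r.length = s + 1 + x.length ∧ r.drop (s + 1) = x ∧
          ∀ β, energy lam1 lam2 z l u (s + 1) (entries r) ≤ Pstar lam1 lam2 z l u (s + 1) β := by
        intro m v hmv hle hv
        obtain ⟨M, hM, hvM⟩ := findSet_spec v st.R (by
          obtain ⟨i, hi, hvi⟩ := exists_mem_Rset (lam1 := lam1) (lam2 := lam2) (z := z) (l := l)
            (u := u) (show 1 ≤ s + 1 by omega) v
          obtain ⟨M, hM, hMu⟩ := hst.union i hi
          exact ⟨M, List.mem_of_getElem? hM, hMu ▸ hvi⟩)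
        set k' := val (findSet v st.R)
        have hk' : k' < s + 1 := by
          have := (List.getElem?_eq_some_iff.1 hM).1
          rwa [hst.lengthR] at this
        -- Position `k'` in the stored list corresponds to `i_{s+1}^* = s - k'`, which leaves
        -- exactly `k'` more entries in the block.
        have hvR : v ∈ Rset lam1 lam2 z l u (s + 1) (s - k') := by
          obtain ⟨M', hM', hMu⟩ := hst.union (s - k') (by omega)
          rw [show s + 1 - 1 - (s - k') = k' by omega, hM, Option.some.injEq] at hM'
          rw [← hMu, ← hM']
          exact hvM
        obtain ⟨i1, i2, i3, i4⟩ := ih hL k' (some v) (v :: x)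
        refine ⟨by rw [i1, List.length_cons]; ring, ?_, fun β => ?_⟩
        · rw [← List.drop_drop, i2]; rfl
        · refine le_trans (energy_step_le h1 i2 (by omega) hvR i3 ?_) (hv ▸ hle β)
          exact fun hk hvs => i4 v rfl hk (by omega) hvs
      obtain ⟨m, v, hmv, hv, hle⟩ := hst.minimize h1 h2 hl hu
      obtain ⟨f1, f2, f3⟩ := fresh m v hmv hle hv
      cases k with
      | zero =>
        simp only [backward, val_bind, hmv]
        exact ⟨f1, f2, fun _ _ => f3, fun α _ h => by omega⟩
      | succ k =>
        cases o with
        | none =>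
          simp only [backward, val_bind, hmv]
          exact ⟨f1, f2, fun h => by omega, fun α h => by simp at h⟩
        | some α =>
          simp only [backward, val_bind]
          obtain ⟨i1, i2, i3, i4⟩ := ih hL k (some α) (α :: x)
          refine ⟨by rw [i1, List.length_cons]; ring, ?_, fun h => by omega, ?_⟩
          · rw [← List.drop_drop, i2]; rfl
          · intro α' hα' _ hk hR
            obtain rfl : α = α' := by simpa using hα'
            rw [show s + 1 - (k + 1) = s - k by omega] at hR
            refine ⟨entries_of_drop i2, energy_step_le h1 i2 (by omega) hR i3 ?_⟩
            exact fun hk hvs => i4 α rfl hk (by omega) hvs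

theorem cost_backward (h1 : 0 < lam1) (h2 : 0 < lam2) (hl : ∀ i, l i ≤ 0) (hu : ∀ i, 0 ≤ u i)
    {N s : ℕ} {L : List (Stage ℝ)} (hL : GoodStages lam1 lam2 z l u s L) (hN : s ≤ N) (k : ℕ)
    (o : Option ℝ) (x : List ℝ) :
    -- The coefficient is `16 · 4` for `minimize` on `4 s + 1` pieces plus `2 + 6 · 16` for
    -- `findSet`.
    cost (backward L k o x) ≤ s * (162 * N + 50) + 1 := by
  induction s generalizing L k o x with
  | zero =>
    obtain rfl : L = [] := hL
    simp [backward]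
  | succ s ih =>
    cases L with
    | nil => exact hL.elim
    | cons st L =>
      obtain ⟨hst, hL⟩ := hL
      have hi := fun k o x => ih hL (by omega) k o x
      obtain ⟨m, v, hmv, -⟩ := hst.minimize h1 h2 hl hu
      have c1 := cost_minimize st.P
      have c2 := cost_findSet v st.R
      have c3 := hst.length_le h1 h2 hl hu (by omega)
      have c4 := hst.flat
      rw [hst.lengthR] at c2
      simp only [add_mul, one_mul] at hi ⊢
      cases k with
      | zero =>
        simp only [backward, cost_bind, hmv, cost_step]
        have := hi (val (findSet v st.R)) (some v) (v :: x)
        omega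
      | succ k =>
        cases o with
        | none =>
          simp only [backward, cost_bind, hmv, cost_step]
          have := hi (val (findSet v st.R)) (some v) (v :: x)
          omega
        | some α =>
          simp only [backward, cost_bind, cost_step]
          have := hi k (some α) (α :: x)
          omega

/-! ### The whole algorithm -/

theorem algorithmRun_spec (h1 : 0 < lam1) (h2 : 0 < lam2) (hl : ∀ i, l i ≤ 0) (hu : ∀ i, 0 ≤ u i) :
    GoodStages lam1 lam2 z l u n (val (algorithmRun lam1 lam2 z l u)).1 ∧
    (val (algorithmRun lam1 lam2 z l u)).2.length = n ∧
    (1 ≤ n → ∀ β, energy lam1 lam2 z l u n (entries (val (algorithmRun lam1 lam2 z l u)).2) ≤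
      Pstar lam1 lam2 z l u n β) ∧
    cost (algorithmRun lam1 lam2 z l u) ≤ 6000 * (n + 1) ^ 3 := by
  have hlen : (List.ofFn fun i => (z i, l i, u i)).length = n := by simp
  have hdata := isData_ofFn (z := z) (l := l) (u := u)
  simp only [algorithmRun]
  revert hlen hdata
  generalize (List.ofFn fun i => (z i, l i, u i)) = ds
  intro hlen hdata
  cases ds with
  | nil =>
    obtain rfl : n = 0 := by simpa using hlen.symm
    refine ⟨by simp [algorithm, GoodStages], by simp [algorithm], fun h => by omega, ?_⟩
    simp [algorithm]
  | cons d ds =>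
    obtain ⟨rfl, hd⟩ := hdata.cons
    simp only [List.length_cons] at hlen
    simp only [zero_add] at hd ⊢
    have hinit := inv_initStage (z := z) h1 h2 hl hu
    have cinit := cost_initStage lam2 (entry z 1) (entry l 1) (entry u 1)
    simp only [algorithm, val_bind, val_pure, cost_bind, cost_step, cost_pure]
    obtain ⟨f1, f2⟩ := forward_spec (N := n) (s := 0) (done := []) h1 h2 hl hu ⟨hinit, rfl⟩ hd
      (by omega)
    rw [show 0 + 1 + ds.length = n by omega] at f1
    obtain ⟨b1, -, b3, -⟩ := backward_spec h1 h2 hl hu f1 0 none []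
    have b4 := cost_backward h1 h2 hl hu f1 le_rfl 0 none []
    refine ⟨f1, by simpa using b1, b3 rfl, ?_⟩
    have : ds.length ≤ n := by omega
    have : ds.length * (5000 * (n + 1) ^ 2 + 1) ≤ n * (5000 * (n + 1) ^ 2 + 1) :=
      Nat.mul_le_mul_right _ this
    have hn : 1 ≤ n := by omega
    nlinarith [Nat.zero_le n, sq_nonneg n]

/-! ### The objective in Euclidean space -/

theorem energy_eq (lam1 lam2 : ℝ) (z l u : Fin n → ℝ) (s : ℕ) (x : ℕ → ℝ) :
    energy lam1 lam2 z l u s x =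
      ((∑ k ∈ Finset.range s, termR lam2 z (k + 1) (x (k + 1)) +
        ∑ k ∈ Finset.range s, (if k = 0 ∨ x k = x (k + 1) then 0 else lam1) : ℝ) : EReal) +
      delta {x : ℕ → ℝ | ∀ k < s, x (k + 1) ∈ Set.Icc (entry l (k + 1)) (entry u (k + 1))} x := by
  induction s with
  | zero => simp [energy, delta]
  | succ s ih =>
    rw [energy, ih, Finset.sum_range_succ, Finset.sum_range_succ]
    simp only [delta, Set.mem_ofPred_eq]
    by_cases hs : x (s + 1) ∈ Set.Icc (entry l (s + 1)) (entry u (s + 1))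
    · have : (∀ k < s + 1, x (k + 1) ∈ Set.Icc (entry l (k + 1)) (entry u (k + 1))) ↔
          ∀ k < s, x (k + 1) ∈ Set.Icc (entry l (k + 1)) (entry u (k + 1)) := by
        refine ⟨fun h k hk => h k (by omega), fun h k hk => ?_⟩
        rcases Nat.lt_succ_iff_lt_or_eq.1 hk with h' | rfl
        · exact h k h'
        · exact hs
      rw [term_of_mem hs]
      simp only [this]
      split_ifs with h <;>
        simp only [add_zero, EReal.coe_add_top, EReal.top_add_coe, ← EReal.coe_add] <;>
        (congr 1; ring)
    · have : ¬ ∀ k < s + 1, x (k + 1) ∈ Set.Icc (entry l (k + 1)) (entry u (k + 1)) :=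
        fun h => hs (h s (by omega))
      rw [term_of_notMem hs, if_neg this, EReal.coe_add_top]
      -- The earlier part may already be `⊤`; it suffices that it is not `⊥`.
      refine EReal.add_top_of_ne_bot ?_
      split_ifs <;> simp [← EReal.coe_add]

theorem entry_succ (v : Fin n → ℝ) (i : Fin n) : entry v (i + 1) = v i := by
  simp [entry]

theorem Bhat_mulVec (x : Fin n → ℝ) (i : Fin (n - 1)) :
    (Bhat n).mulVec x i = entry x (i + 1) - entry x (i + 1 + 1) := by
  have hi : (i : ℕ) < n := by omega
  have hi' : (i : ℕ) + 1 < n := by omega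
  have e1 : entry x (i + 1) = x ⟨i, hi⟩ := by simp [entry, hi]
  have e2 : entry x (i + 1 + 1) = x ⟨i + 1, hi'⟩ := by simp [entry, hi']
  rw [e1, e2]
  simp only [Matrix.mulVec, dotProduct, Bhat, Matrix.of_apply]
  rw [Finset.sum_eq_add (⟨i, hi⟩ : Fin n) ⟨i + 1, hi'⟩]
  · simp [sub_eq_add_neg]
  · simp
  · rintro j - ⟨hj1, hj2⟩
    have : (j : ℕ) ≠ i := fun h => hj1 (Fin.ext h)
    have : (j : ℕ) ≠ i + 1 := fun h => hj2 (Fin.ext h)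
    simp [*]
  · simp
  · simp

theorem objective_eq_energy (lam1 lam2 : ℝ) (z l u : Fin n → ℝ) (x : EuclideanSpace ℝ (Fin n)) :
    ((1 / (2 * 1) * ‖x - WithLp.toLp 2 z‖ ^ 2 : ℝ) : EReal) + fusedReg lam1 lam2 l u x =
      energy lam1 lam2 z l u n (entry x.ofLp) := by
  rw [energy_eq, fusedReg, ← add_assoc, ← EReal.coe_add]
  congr 1
  · congr 1
    rw [EuclideanSpace.norm_sq_eq, ← Fin.sum_univ_eq_sum_range
      (fun k => termR lam2 z (k + 1) (entry x.ofLp (k + 1)))]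
    have hB : lam1 * (hammingNorm ((Bhat n).mulVec x.ofLp) : ℝ) = ∑ k ∈ Finset.range n,
        (if k = 0 ∨ entry x.ofLp k = entry x.ofLp (k + 1) then 0 else lam1) := by
      have hham : (hammingNorm ((Bhat n).mulVec x.ofLp) : ℝ) = ∑ i : Fin (n - 1),
          if (Bhat n).mulVec x.ofLp i ≠ 0 then 1 else 0 := by
        simp only [hammingNorm, Finset.card_filter, Nat.cast_sum, Nat.cast_ite, Nat.cast_one,
          Nat.cast_zero]
      rw [hham, Finset.mul_sum]
      rcases Nat.eq_zero_or_pos n with rfl | hn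
      · simp
      · obtain ⟨m, rfl⟩ : ∃ m, n = m + 1 := ⟨n - 1, by omega⟩
        -- Splitting off the vanishing summand `k = 0` leaves the `n - 1` differences in `B̂ x`.
        rw [Finset.sum_range_succ', ← Fin.sum_univ_eq_sum_range
          (fun k => if k + 1 = 0 ∨ entry x.ofLp (k + 1) = entry x.ofLp (k + 1 + 1) then (0 : ℝ)
            else lam1)]
        simp only [true_or, if_true, add_zero]
        refine Finset.sum_congr rfl fun i _ => ?_
        rw [Bhat_mulVec]
        by_cases h : entry x.ofLp (i + 1) = entry x.ofLp (i + 1 + 1)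
        · simp [h]
        · simp [h, sub_eq_zero]
    have hH : lam2 * (hammingNorm x.ofLp : ℝ) = ∑ i : Fin n, if x.ofLp i = 0 then 0 else lam2 := by
      have hham : (hammingNorm x.ofLp : ℝ) = ∑ i : Fin n, if x.ofLp i ≠ 0 then 1 else 0 := by
        simp only [hammingNorm, Finset.card_filter, Nat.cast_sum, Nat.cast_ite, Nat.cast_one,
          Nat.cast_zero]
      rw [hham, Finset.mul_sum]
      refine Finset.sum_congr rfl fun i _ => ?_
      by_cases h : x.ofLp i = 0 <;> simp [h]
    rw [hB, hH]
    simp only [termR, entry_succ, Finset.sum_add_distrib, ← Finset.mul_sum]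
    simp only [PiLp.sub_apply, Real.norm_eq_abs, sq_abs]
    ring
  · simp only [delta, box, Set.mem_ofPred_eq]
    congr 1
    refine propext ⟨fun h k hk => ?_, fun h i => ?_⟩
    · have := h ⟨k, hk⟩
      simpa [entry, hk] using this
    · simpa [entry_succ] using h i i.2

/-- The bound for the output holds against every `β`. Taking for `β` the last entry of the
competitor and applying `Pstar_le_energy` closes the chain. -/
theorem algorithmRun_mem_prox (h1 : 0 < lam1) (h2 : 0 < lam2) (hl : ∀ i, l i ≤ 0)
    (hu : ∀ i, 0 ≤ u i) :
    WithLp.toLp 2 (fun i : Fin n => (val (algorithmRun lam1 lam2 z l u)).2.getD i 0) ∈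
      prox 1 (fusedReg lam1 lam2 l u) (WithLp.toLp 2 z) := by
  obtain ⟨-, hlen, hle, -⟩ := algorithmRun_spec (z := z) h1 h2 hl hu
  set r := (val (algorithmRun lam1 lam2 z l u)).2
  intro y _
  simp only [Set.mem_ofPred_eq]
  rw [objective_eq_energy, objective_eq_energy]
  rcases Nat.eq_zero_or_pos n with rfl | hn
  · exact le_rfl
  · have hr : entry (fun i : Fin n => r.getD i 0) = entries r := by
      ext k
      unfold entry entries
      split_ifs with h
      · rfl
      · rw [List.getD_eq_default _ _ (by omega)]
    rw [hr]
    exact (hle hn _).trans (Pstar_le_energy hn _)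

end Loops

/-! ### Growth rates -/

theorem isBigOPow_cube (C : ℝ) : IsBigOPow (fun n : ℕ => C * ((n : ℝ) + 1) ^ 3) 3 := by
  refine ⟨fun _ => 0, tendsto_const_nhds, ?_⟩
  refine IsBigO.of_bound (|C| * 8) ?_
  filter_upwards [eventually_ge_atTop 1] with n hn
  have hn' : (1 : ℝ) ≤ n := by exact_mod_cast hn
  have h3 : (n : ℝ) ^ (3 + 0 : ℝ) = (n : ℝ) ^ 3 := by
    rw [add_zero]; exact_mod_cast Real.rpow_natCast (n : ℝ) 3
  rw [h3, norm_mul, Real.norm_eq_abs, Real.norm_of_nonneg (by positivity),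
    Real.norm_of_nonneg (by positivity), mul_assoc]
  refine mul_le_mul_of_nonneg_left ?_ (abs_nonneg C)
  calc ((n : ℝ) + 1) ^ 3 ≤ (2 * n) ^ 3 := by gcongr; linarith
    _ = 8 * (n : ℝ) ^ 3 := by ring

/-- With `ε_s = √(log 3s) / log s` the power `s ^ ε_s` is exactly the exponential once `log s > 0`.
For `s ≥ 3` one has `log 3s ≤ 2 log s`, so `ε_s ≤ √2 / √(log s)`, which tends to `0`. -/
theorem isBigOPow_mul_exp_sqrt_log (c : ℝ) :
    IsBigOPow (fun s : ℕ => c * s * Real.exp (1 * √(Real.log (3 * s)))) 1 := by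
  have hlog : Tendsto (fun s : ℕ => Real.log s) atTop atTop :=
    Real.tendsto_log_atTop.comp tendsto_natCast_atTop_atTop
  refine ⟨fun s => √(Real.log (3 * s)) / Real.log s, ?_, ?_⟩
  · have hlim : Tendsto (fun s : ℕ => √2 / √(Real.log s)) atTop (𝓝 0) :=
      Tendsto.const_div_atTop (Real.tendsto_sqrt_atTop.comp hlog) _
    refine squeeze_zero' ?_ ?_ hlim
    · filter_upwards [hlog.eventually_ge_atTop 0] with s hs
      positivity
    · filter_upwards [hlog.eventually_gt_atTop 0, eventually_ge_atTop 3] with s hs hs3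
      have hs3' : (3 : ℝ) ≤ s := by exact_mod_cast hs3
      have h1 : Real.log (3 * s) ≤ 2 * Real.log s := by
        rw [Real.log_mul (by norm_num) (by positivity), two_mul]
        gcongr
      have h2 : 0 < √(Real.log s) := Real.sqrt_pos.2 hs
      rw [div_le_div_iff₀ hs h2]
      calc √(Real.log (3 * s)) * √(Real.log s) ≤ √(2 * Real.log s) * √(Real.log s) := by gcongr
        _ = √2 * (√(Real.log s) * √(Real.log s)) := by
            rw [Real.sqrt_mul (by norm_num)]; ring
        _ = √2 * Real.log s := by rw [Real.mul_self_sqrt hs.le]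
  · refine IsBigO.of_bound |c| ?_
    filter_upwards [hlog.eventually_gt_atTop 0, eventually_ge_atTop 1] with s hs hs1
    have hs0 : (0 : ℝ) < s := by exact_mod_cast hs1
    have : (s : ℝ) ^ (1 + √(Real.log (3 * s)) / Real.log s) =
        s * Real.exp (1 * √(Real.log (3 * s))) := by
      rw [Real.rpow_add hs0, Real.rpow_one, Real.rpow_def_of_pos hs0]
      congr 2
      field_simp
    rw [this, mul_assoc, norm_mul, Real.norm_eq_abs]

end FusedL0

/-! ### The main theorem -/

open FusedL0 in
theorem lemma3p4 :
    -- the number of pieces of `P_s^*`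
    (∃ c₁ c₂ : ℝ, 0 < c₁ ∧ 0 < c₂ ∧
      IsBigOPow (fun s : ℕ => 3 * c₁ * s * Real.exp (c₂ * √(Real.log (3 * s)))) 1 ∧
      ∀ (n : ℕ) (lam1 lam2 : ℝ) (z l u : Fin n → ℝ), 0 < lam1 → 0 < lam2 →
        (∀ i, l i ≤ 0) → (∀ i, 0 ≤ u i) →
        ∀ s : ℕ, 2 ≤ s → s ≤ n →
          (∃ k : ℕ, (k : ℝ) ≤ 3 * c₁ * s * Real.exp (c₂ * √(Real.log (3 * s))) ∧
            IsPLQ (Pstar lam1 lam2 z l u s) k) ∧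
          -- the same bound for the list of pieces that the algorithm computes
          ∃ st : Stage ℝ, (algorithmRun lam1 lam2 z l u).val.1[n - s]? = some st ∧
            (st.P.length : ℝ) ≤ 3 * c₁ * s * Real.exp (c₂ * √(Real.log (3 * s)))) ∧
    -- the algorithm computes what it should, in `O(n^{3+o(1)})` operations
    ∃ T : ℕ → ℝ, IsBigOPow T 3 ∧
      ∀ (n : ℕ) (lam1 lam2 : ℝ) (z l u : Fin n → ℝ), 0 < lam1 → 0 < lam2 →
        (∀ i, l i ≤ 0) → (∀ i, 0 ≤ u i) →
        ((algorithmRun lam1 lam2 z l u).cost : ℝ) ≤ T n ∧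
        (∀ s : ℕ, 1 ≤ s → s ≤ n →
          ∃ st : Stage ℝ, (algorithmRun lam1 lam2 z l u).val.1[n - s]? = some st ∧
            pieceFun st.P = Pstar lam1 lam2 z l u s ∧
            (∃ α : ℝ, IsMinOn (Pstar lam1 lam2 z l u s) Set.univ α) ∧
            ∀ i : ℕ, i < s → ∃ L : List (Ivl ℝ), st.R[s - 1 - i]? = some L ∧
              unionSet L = Rset lam1 lam2 z l u s i) ∧
        (algorithmRun lam1 lam2 z l u).val.2.length = n ∧
        WithLp.toLp 2 (fun i : Fin n => (algorithmRun lam1 lam2 z l u).val.2.getD i 0) ∈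
          prox 1 (fusedReg lam1 lam2 l u) (WithLp.toLp 2 z) := by
  -- With `c₁ = 2` the bound is at least `6 s`, which exceeds `4 s + 1` for `s ≥ 2`; any `c₂ > 0`
  -- would do.
  refine ⟨⟨2, 1, by norm_num, by norm_num, isBigOPow_mul_exp_sqrt_log _, ?_⟩,
    fun n => 6000 * ((n : ℝ) + 1) ^ 3, isBigOPow_cube _, ?_⟩
  · intro n lam1 lam2 z l u h1 h2 hl hu s hs hsn
    obtain ⟨hgood, -⟩ := algorithmRun_spec (z := z) h1 h2 hl hu
    obtain ⟨st, hst, hinv⟩ := hgood.exists_inv (by omega) hsn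
    have hlen : (st.P.length : ℝ) ≤ 3 * 2 * s * Real.exp (1 * √(Real.log (3 * s))) := by
      have hs' : (2 : ℝ) ≤ s := by exact_mod_cast hs
      have hP : (st.P.length : ℝ) ≤ 4 * s + 1 := by
        exact_mod_cast hinv.length_le h1 h2 hl hu (by omega)
      have hexp : 1 ≤ Real.exp (1 * √(Real.log (3 * s))) := Real.one_le_exp (by positivity)
      calc (st.P.length : ℝ) ≤ 3 * 2 * s * 1 := by linarith
        _ ≤ _ := by gcongr
    exact ⟨⟨_, hlen, hinv.isPLQ⟩, st, hst, hlen⟩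
  · intro n lam1 lam2 z l u h1 h2 hl hu
    obtain ⟨hgood, hlen, -, hcost⟩ := algorithmRun_spec (z := z) h1 h2 hl hu
    refine ⟨by dsimp only; exact_mod_cast hcost, ?_, hlen, algorithmRun_mem_prox h1 h2 hl hu⟩
    intro s hs hsn
    obtain ⟨st, hst, hinv⟩ := hgood.exists_inv hs hsn
    obtain ⟨m, v, -, hv, hle⟩ := hinv.minimize h1 h2 hl hu
    exact ⟨st, hst, pieceFun_eq hinv.value hinv.cover,
      ⟨v, fun α _ => hv.symm ▸ hle α⟩, hinv.union⟩
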